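/- **Notation.** For a Borel probability measure $\mu$ on $\mathbf R$ and $\alpha>0$, let $\omega_1,\omega_2,\dots$ be independent with law $\mu$, let $E_\alpha(\omega)=\bigcap_{k\ge1}\bigcup_{n\ge k}\overline B(\omega_n,n^{-\alpha})$, and let $f_\mu(\alpha)$ be the almost sure value of $\dim_H E_\alpha(\omega)$. The lower and upper local dimensions of $\mu$ at $x$ are $$\underline d_\mu(x)=\sup\{s\in\mathbf R:\exists c\ \forall r>0,\ \mu(B(x,r))\le c r^s\},\qquad \overline d_\mu(x)=\inf\{s\in\mathbf R:\exists c>0\ \forall r\in(0,1],\ \mu(B(x,r))\ge c r^s\}$$ (values in $[-\infty,\infty]$, $\inf\emptyset=\infty$). For $s\in\mathbf R$ let $F_\mu(s)=\dim_H\{x\in\operatorname{supp}\mu:\underline d_\mu(x)\le s\}$ and $H_\mu(s)=\dim_P\{x:\underline d_\mu(x)\le s\}$, where $\dim_H$ and $\dim_P$ are Hausdorff and packing dimension ($\dim\emptyset=0$). Let $\bar F_\mu(s)=\inf\{h(s):h\ge F_\mu,\ h:\mathbf R\to\mathbf R \text{ increasing and 1-Lipschitz}\}$. **The measure.** Let $\lambda\in(0,1/3)$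 and $\beta>1$, and let $\nu$ be the Bernoulli convolution with parameter $\lambda$, that is, the law of $\sum_{n\ge0}\pm\lambda^n$ with independent fair signs. Let $C$ be the ternary Cantor set and let $C_k$ be the $k$-th step of its standard construction, a union of $2^k$ closed intervals of length $3^{-k}$. For each $k\ge0$ and each interval $I$ of $C_k$ choose a nonconstant affine map $\varphi_{k,I}$ that maps $\operatorname{supp}\nu$ into the closed middle ninth of $I$ (any choice is allowed), let $\mu_k$ be the sum of the $2^k$ images of $\nu$ under these maps, and let $$\mu=(1-2^{1-\beta})\sum_{k=0}^\infty 2^{-\beta k}\mu_k .$$ Put $s_0=\dfrac{\log 2}{-\log\lambda}$, $s_1=\dfrac{\beta\log2}{\log3}$, $d_1=\dfrac{\log 2}{\log 3}$. **Claim.** 1. $\mu$ is a probability measure and $\operatorname{supp}\mu=C\cup\bigcup_{k\ge0}\operatorname{supp}\mu_k$. 2. $\underline d_\mu(x)=\overline d_\mu(x)$ for every $x\in\mathbf R$; the common value is $s_0$ if $x\in\bigcup_{k\ge0}\operatorname{supp}\mu_k$, it is $s_1$ if $x\in C$, and it is $\infty$ if $x\notin\operatorname{supp}\mu$. 3. For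 every $s\in\mathbf R$, $F_\mu(s)=H_\mu(s)$, and $F_\mu(s)=0$ if $s<s_0$, $F_\mu(s)=s_0$ if $s_0\le s<s_1$, $F_\mu(s)=d_1$ if $s\ge s_1$. 4. For every $s\ge0$, $\bar F_\mu(s)=\max\bigl(\min(s,s_0),\ \min(s,s_1)-(s_1-d_1)\bigr)$, and $\bar F_\mu$ is not concave on $(0,\infty)$. 5. For every $\alpha>0$, $\dim_H E_\alpha(\omega)$ is almost surely constant, and its almost sure value is $f_\mu(\alpha)=\bar F_\mu(1/\alpha)$. In particular, if $1/\alpha\le s_1$ then $$f_\mu(\alpha)\ \ge\ \frac1\alpha-(s_1-d_1)=\frac1\alpha-(\beta-1)\frac{\log2}{\log3}.$$ -/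

import Mathlib

open Set Filter Topology MeasureTheory
open scoped NNReal ENNReal

noncomputable section

/-- The random limsup set `E_α(ω) = ⋂_k ⋃_{n ≥ k} B[ω_n, n^{-α}]`, `n = 1, 2, …`
(the `n`-th centre is stored in coordinate `n - 1`). -/
def limsupBalls {X : Type*} [PseudoMetricSpace X] (α : ℝ) (ω : ℕ → X) : Set X :=
  ⋂ k : ℕ, ⋃ n : ℕ, ⋃ _ : k ≤ n, Metric.closedBall (ω n) (((n : ℝ) + 1) ^ (-α))

/-- `f_μ(α)`: the almost sure value of `dim_H E_α` when the centres are independent with law `μ`.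
It is defined here as the essential supremum of `dim_H E_α`, which is the almost sure value
whenever `dim_H E_α` is almost surely constant. -/
def coveringDim {X : Type*} [MetricSpace X] [MeasurableSpace X]
    (μ : Measure X) (α : ℝ) : ℝ≥0∞ :=
  essSup (fun ω : ℕ → X => dimH (limsupBalls α ω)) (Measure.infinitePi fun _ : ℕ => μ)

/-- The lower local dimension of `μ` at `x`. -/
def lowerLocalDim {X : Type*} [PseudoMetricSpace X] [MeasurableSpace X]
    (μ : Measure X) (x : X) : EReal :=
  sSup ((fun s : ℝ => (s : EReal)) ''
    {s : ℝ | ∃ c : ℝ, ∀ r : ℝ, 0 < r → μ (Metric.ball x r) ≤ ENNReal.ofReal (c * r ^ s)})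

/-- The upper local dimension of `μ` at `x`. The lower bound `c r ^ s`, with `c > 0`, is asked for
small radii only. It is `⊤` outside the support of `μ`. -/
def upperLocalDim {X : Type*} [PseudoMetricSpace X] [MeasurableSpace X]
    (μ : Measure X) (x : X) : EReal :=
  sInf ((fun s : ℝ => (s : EReal)) ''
    {s : ℝ | ∃ c : ℝ, 0 < c ∧ ∀ r : ℝ, 0 < r → r ≤ 1 →
      ENNReal.ofReal (c * r ^ s) ≤ μ (Metric.ball x r)})

/-- The Hausdorff spectrum `F_μ` of the lower local dimension. -/
def hausdorffSpectrum {X : Type*} [MetricSpace X] [MeasurableSpace X]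
    (μ : Measure X) (s : ℝ) : ℝ≥0∞ :=
  dimH {x : X | x ∈ μ.support ∧ lowerLocalDim μ x ≤ (s : EReal)}

/-- The upper box (Minkowski) dimension `limsup_{r → 0} log N_r(A) / (- log r)`, where `N_r(A)` is
the least number of closed balls of radius `r` that cover `A`. -/
def upperBoxDim {X : Type*} [PseudoMetricSpace X] (A : Set X) : EReal :=
  limsup (fun r : ℝ≥0 =>
    ENNReal.log (Metric.externalCoveringNumber r A : ℝ≥0∞) / ((-Real.log (r : ℝ) : ℝ) : EReal))
    (𝓝[>] (0 : ℝ≥0))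

/-- The packing dimension: the infimum of those `t` for which the set has a countable cover by
sets of upper box dimension at most `t`. -/
def packingDim {X : Type*} [PseudoMetricSpace X] (S : Set X) : ℝ≥0∞ :=
  sInf {t : ℝ≥0∞ | ∃ A : ℕ → Set X, (∀ i, upperBoxDim (A i) ≤ (t : EReal)) ∧ S ⊆ ⋃ i, A i}

/-- The packing spectrum `H_μ` of the lower local dimension. -/
def packingSpectrum {X : Type*} [PseudoMetricSpace X] [MeasurableSpace X]
    (μ : Measure X) (s : ℝ) : ℝ≥0∞ :=
  packingDim {x : X | lowerLocalDim μ x ≤ (s : EReal)}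

/-- The increasing 1-Lipschitz hull of `g`: the pointwise infimum of all increasing 1-Lipschitz
functions that lie above `g`. -/
def increasingLipschitzHull (g : ℝ → ℝ) (x : ℝ) : ℝ :=
  sInf {y : ℝ | ∃ h : ℝ → ℝ, Monotone h ∧ LipschitzWith 1 h ∧ (∀ z, g z ≤ h z) ∧ y = h x}

/-- `F̄_μ`, the increasing 1-Lipschitz hull of the Hausdorff spectrum. -/
def hausdorffSpectrumHull {X : Type*} [MetricSpace X] [MeasurableSpace X]
    (μ : Measure X) (s : ℝ) : ℝ :=
  increasingLipschitzHull (fun z => (hausdorffSpectrum μ z).toReal) s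

/-- The Bernoulli convolution with parameter `lam`: the law of `∑_{n ≥ 0} ± lam ^ n`, where the
signs are independent and fair. -/
def bernoulliConvolution (lam : ℝ) : Measure ℝ :=
  (Measure.infinitePi fun _ : ℕ => (PMF.uniformOfFintype Bool).toMeasure).map
    (fun σ : ℕ → Bool => ∑' n : ℕ, (if σ n then (1 : ℝ) else -1) * lam ^ n)

/-- The left end point of the interval of `C_k` with address `w`. The `2 ^ k` intervals of the
`k`-th step of the construction of the ternary Cantor set are
`[cantorLeft w, cantorLeft w + 3^{-k}]`, for `w : Fin k → Bool`. -/
def cantorLeft {k : ℕ} (w : Fin k → Bool) : ℝ :=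
  ∑ i : Fin k, if w i then 2 * (1 / 3 : ℝ) ^ ((i : ℕ) + 1) else 0

/-- The closed middle ninth of the interval of `C_k` with address `w`. -/
def middleNinth {k : ℕ} (w : Fin k → Bool) : Set ℝ :=
  Icc (cantorLeft w + 4 / 9 * (1 / 3 : ℝ) ^ k) (cantorLeft w + 5 / 9 * (1 / 3 : ℝ) ^ k)

/-- `μ_k`: the sum of the `2 ^ k` images of the Bernoulli convolution under the affine maps
`x ↦ a k w * x + b k w`. -/
def levelMeasure (lam : ℝ) (a b : (k : ℕ) → (Fin k → Bool) → ℝ) (k : ℕ) : Measure ℝ :=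
  ∑ w : Fin k → Bool, (bernoulliConvolution lam).map (fun x => a k w * x + b k w)

/-- `μ = (1 - 2^{1-β}) ∑_k 2^{-βk} μ_k`. -/
def gapMeasure (lam β : ℝ) (a b : (k : ℕ) → (Fin k → Bool) → ℝ) : Measure ℝ :=
  ENNReal.ofReal (1 - 2 ^ (1 - β)) •
    Measure.sum fun k : ℕ => ENNReal.ofReal (2 ^ (-β * k)) • levelMeasure lam a b k

end

/-! The support consists of countably many affine copies of `supp ν` and of the Cantor set `C`, and
`μ` is regular at each point with one of two exponents. Away from `C` only finitely many copies are
near a given point, so on a copy `μ` scales like `ν`, with exponent `s₀`. A copy of level `j` has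
distance at least `3^{-j}/9` from `C`. Hence a ball of radius `r ≈ 3^{-l}` centred on `C` meets only
levels from about `l` on; these have total mass `2^{(1-β)l}`, and the ball sees about the fraction
`2^{-l}` of it, which makes `2^{-βl} = (3^{-l})^{s₁}`. The same tail bounds the mass of the whole
`r`-neighbourhood of `C` by a multiple of `r^{s₁-d₁}`. The spectra follow from the box dimensions
`s₀` of a copy and `d₁` of `C`, together with Frostman's lemma. The hull is determined by the two
jumps of the spectrum.

Upper bound for the random set: `E_α` lies in the support. Its part in the copies has dimension at
most `min (1/α) s₀`. Its part in `C` uses only balls whose centre is within its radius of `C`.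
Weighting each such ball by the probability `r_n^{s₁-d₁}`, the first moment of `∑ diam^t` is finite
for `t > 1/α - (s₁-d₁)` (`ae_dimH_limsup_le`).

Lower bound: `ae_le_dimH_limsupBalls` treats a tree of dimension `d` whose words of length `m` carry
disjoint sets of mass `ρ^{mD}` at distance `O(ρ^m)`, and gives `min d (1/α - (D-d))`. It is used
with `D = d = s₀` for the copy of level 0, and with `D = s₁`, `d = d₁` and the middle ninths for
`C`. About `ρ^{-m/α}` balls have radius at least `ρ^m`. If `m ≈ θk` and `(1/α - (D-d))θ > d`, then
with overwhelming probability every word of length `k` has an extension of length `m` whose set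
contains the centre of such a ball (`ae_forall_exists_hit`). Tossing fair coins except on very
sparse blocks `[k, θk)`, where such an extension is followed, gives a measure on the limsup set of
dimension nearly `d/θ` (`exists_measure_of_hit`).

All sets are handled through `IsCoding`, which turns metric estimates into counts of cylinders of
the binary tree. -/

/-! ### Codings of self-similar sets by the binary tree -/

/-- `∑ ± ρ ^ n`, with the signs given by `u`. -/
noncomputable def signSeries (ρ : ℝ) (u : ℕ → Bool) : ℝ :=
  ∑' n : ℕ, (if u n then (1 : ℝ) else -1) * ρ ^ n

/-- Two sequences agree in the coordinates below `l`. -/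
def AgreeBelow (l : ℕ) (u v : ℕ → Bool) : Prop := ∀ i < l, u i = v i

/-- A parametrization by the binary tree under which a cylinder of length `l` has
diameter comparable to `ρ ^ l`, and distinct cylinders of length `l` have distance
at least a multiple of `ρ ^ l`. -/
structure IsCoding (ρ : ℝ) (F : (ℕ → Bool) → ℝ) : Prop where
  upper : ∃ A : ℝ, 0 < A ∧ ∀ u v l, AgreeBelow l u v → |F u - F v| ≤ A * ρ ^ l
  lower : ∃ B : ℝ, 0 < B ∧ ∀ u v l, |F u - F v| < B * ρ ^ l → AgreeBelow l u v

theorem abs_sign_mul_pow {ρ : ℝ} (h0 : 0 < ρ) (u : ℕ → Bool) (n : ℕ) :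
    ‖(if u n then (1 : ℝ) else -1) * ρ ^ n‖ = ρ ^ n := by
  rw [norm_mul, Real.norm_eq_abs, Real.norm_eq_abs, abs_of_pos (pow_pos h0 n)]
  split_ifs <;> simp

theorem summable_signSeries {ρ : ℝ} (h0 : 0 < ρ) (h1 : ρ < 1) (u : ℕ → Bool) :
    Summable fun n : ℕ => (if u n then (1 : ℝ) else -1) * ρ ^ n :=
  .of_norm_bounded (summable_geometric_of_lt_one h0.le h1) fun n => (abs_sign_mul_pow h0 u n).le

theorem abs_signSeries_le {ρ : ℝ} (h0 : 0 < ρ) (h1 : ρ < 1) (u : ℕ → Bool) :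
    |signSeries ρ u| ≤ (1 - ρ)⁻¹ :=
  tsum_of_norm_bounded (hasSum_geometric_of_lt_one h0.le h1) fun n => (abs_sign_mul_pow h0 u n).le

theorem signSeries_split {ρ : ℝ} (h0 : 0 < ρ) (h1 : ρ < 1) (u : ℕ → Bool) (l : ℕ) :
    signSeries ρ u = ∑ i ∈ Finset.range l, (if u i then (1 : ℝ) else -1) * ρ ^ i
      + ρ ^ l * signSeries ρ (fun i => u (i + l)) := by
  rw [signSeries, ← (summable_signSeries h0 h1 u).sum_add_tsum_nat_add l, signSeries,
    ← tsum_mul_left]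
  congr 2
  ext i
  ring

theorem signSeries_sub_of_agree {ρ : ℝ} (h0 : 0 < ρ) (h1 : ρ < 1) {u v : ℕ → Bool} {l : ℕ}
    (h : AgreeBelow l u v) : signSeries ρ u - signSeries ρ v =
      ρ ^ l * (signSeries ρ (fun i => u (i + l)) - signSeries ρ (fun i => v (i + l))) := by
  rw [signSeries_split h0 h1 u l, signSeries_split h0 h1 v l,
    Finset.sum_congr rfl fun i hi => by rw [h i (Finset.mem_range.1 hi)]]
  ring

/-- The first terms differ by 2, and each of the two tails is at most `ρ / (1 - ρ)` in absolute
value. -/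
theorem le_abs_signSeries_sub {ρ : ℝ} (h0 : 0 < ρ) (h1 : ρ < 1) {u v : ℕ → Bool}
    (h : u 0 ≠ v 0) : 2 - 2 * ρ * (1 - ρ)⁻¹ ≤ |signSeries ρ u - signSeries ρ v| := by
  have key : ∀ u v : ℕ → Bool, u 0 = true → v 0 = false →
      2 - 2 * ρ * (1 - ρ)⁻¹ ≤ signSeries ρ u - signSeries ρ v := by
    intro u v hu hv
    rw [signSeries_split h0 h1 u 1, signSeries_split h0 h1 v 1]
    have h2 := abs_le.1 (abs_signSeries_le h0 h1 fun i => u (i + 1))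
    have h3 := abs_le.1 (abs_signSeries_le h0 h1 fun i => v (i + 1))
    simp only [Finset.sum_range_one, hu, hv, pow_zero, pow_one, if_true]
    norm_num
    nlinarith
  cases hu : u 0 <;> cases hv : v 0
  · simp_all
  · rw [abs_sub_comm]
    exact (key v u hv hu).trans (le_abs_self _)
  · exact (key u v hu hv).trans (le_abs_self _)
  · simp_all

theorem exists_first_difference {l : ℕ} {u v : ℕ → Bool} (h : ¬ AgreeBelow l u v) :
    ∃ m < l, AgreeBelow m u v ∧ u m ≠ v m := by
  classical
  have h' : ∃ m, u m ≠ v m := by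
    simp only [AgreeBelow] at h
    push Not at h
    exact ⟨h.choose, h.choose_spec.2⟩
  refine ⟨Nat.find h', ?_, fun i hi => not_not.1 (Nat.find_min h' hi), Nat.find_spec h'⟩
  simp only [AgreeBelow] at h
  push Not at h
  obtain ⟨i, hi, hne⟩ := h
  exact (Nat.find_min' h' hne).trans_lt hi

theorem signSeries_le_of_agree {ρ : ℝ} (h0 : 0 < ρ) (h1 : ρ < 1) {u v : ℕ → Bool} {l : ℕ}
    (h : AgreeBelow l u v) : |signSeries ρ u - signSeries ρ v| ≤ 2 * (1 - ρ)⁻¹ * ρ ^ l := by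
  rw [signSeries_sub_of_agree h0 h1 h, abs_mul, abs_of_pos (pow_pos h0 l), mul_comm]
  gcongr
  refine (abs_sub _ _).trans ?_
  linarith [abs_signSeries_le h0 h1 fun i => u (i + l), abs_signSeries_le h0 h1 fun i => v (i + l)]

/-- At a first difference `m < l` the points are at least `(2 - 2ρ/(1-ρ)) ρ^m` apart, and this
constant is positive because `ρ < 1/2`. The factor `ρ` on the left records that `m + 1 ≤ l`; it
keeps the constant sharp, which matters for `ρ = 1/3`. -/
theorem agree_of_signSeries_lt {ρ : ℝ} (h0 : 0 < ρ) (h1 : ρ < 1 / 2) {u v : ℕ → Bool} {l : ℕ}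
    (h : |signSeries ρ u - signSeries ρ v| * ρ < (2 - 2 * ρ * (1 - ρ)⁻¹) * ρ ^ l) :
    AgreeBelow l u v := by
  by_contra hne
  obtain ⟨m, hm, hag, hd⟩ := exists_first_difference hne
  have hpos : 0 < 2 - 2 * ρ * (1 - ρ)⁻¹ := by
    have : 2 * ρ * (1 - ρ)⁻¹ < 2 := by
      rw [← div_eq_mul_inv, div_lt_iff₀ (by linarith)]
      linarith
    linarith
  have h2 := le_abs_signSeries_sub h0 (by linarith) (u := fun i => u (i + m))
    (v := fun i => v (i + m)) (by simpa using hd)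
  rw [signSeries_sub_of_agree h0 (by linarith) hag, abs_mul, abs_of_pos (pow_pos h0 m)] at h
  have h3 : ρ ^ l ≤ ρ ^ (m + 1) := pow_le_pow_of_le_one h0.le (by linarith) hm
  have h4 : ρ ^ (m + 1) * (2 - 2 * ρ * (1 - ρ)⁻¹) ≤ ρ ^ m * |signSeries ρ (fun i => u (i + m)) -
      signSeries ρ (fun i => v (i + m))| * ρ := by
    calc ρ ^ (m + 1) * (2 - 2 * ρ * (1 - ρ)⁻¹) = ρ ^ m * (2 - 2 * ρ * (1 - ρ)⁻¹) * ρ := by ring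
      _ ≤ _ := by gcongr
  nlinarith

theorem isCoding_signSeries {ρ : ℝ} (h0 : 0 < ρ) (h1 : ρ < 1 / 2) {a : ℝ} (ha : a ≠ 0) (b : ℝ) :
    IsCoding ρ fun u => a * signSeries ρ u + b := by
  have ha' : 0 < |a| := abs_pos.2 ha
  have hsub : ∀ u v, |a * signSeries ρ u + b - (a * signSeries ρ v + b)| =
      |a| * |signSeries ρ u - signSeries ρ v| := by
    intro u v
    rw [← abs_mul]
    congr 1
    ring
  refine ⟨⟨|a| * (2 * (1 - ρ)⁻¹), ?_, fun u v l h => ?_⟩,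
    ⟨|a| * ((2 - 2 * ρ * (1 - ρ)⁻¹) / ρ), ?_, fun u v l h => ?_⟩⟩
  · have : 0 < 1 - ρ := by linarith
    positivity
  · rw [hsub, mul_assoc]
    gcongr
    exact signSeries_le_of_agree h0 (by linarith) h
  · have : 2 * ρ * (1 - ρ)⁻¹ < 2 := by
      rw [← div_eq_mul_inv, div_lt_iff₀ (by linarith)]
      linarith
    exact mul_pos ha' (div_pos (by linarith) h0)
  · rw [hsub, mul_assoc] at h
    have h := lt_of_mul_lt_mul_left h ha'.le
    rw [div_mul_eq_mul_div, lt_div_iff₀ h0] at h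
    exact agree_of_signSeries_lt h0 h1 h

/-! ### The Cantor set as a coded set -/

/-- The point of the Cantor set with ternary digits `2 u_0, 2 u_1, …`. -/
noncomputable def cantorPoint (u : ℕ → Bool) : ℝ :=
  ∑' i : ℕ, if u i then 2 * (1 / 3 : ℝ) ^ (i + 1) else 0

theorem summable_cantorPoint (u : ℕ → Bool) :
    Summable fun i : ℕ => if u i then 2 * (1 / 3 : ℝ) ^ (i + 1) else 0 := by
  refine .of_nonneg_of_le (fun i => ?_) (fun i => ?_)
    ((summable_geometric_of_lt_one (by norm_num) (by norm_num : (1 / 3 : ℝ) < 1)).mul_left 2)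
  · split_ifs <;> positivity
  · split_ifs
    · gcongr 2 * ?_
      exact pow_le_pow_of_le_one (by norm_num) (by norm_num) (by lia)
    · positivity

/-- A digit 0 or 2 is `1 ± 1`, and the constant parts sum to `∑ 3^{-(i+1)} = 1/2`. -/
theorem cantorPoint_eq (u : ℕ → Bool) :
    cantorPoint u = 1 / 3 * signSeries (1 / 3) u + 1 / 2 := by
  have hg : HasSum (fun i : ℕ => (1 / 3 : ℝ) * (1 / 3 : ℝ) ^ i) (1 / 2) := by
    have := (hasSum_geometric_of_lt_one (by norm_num) (by norm_num : (1 / 3 : ℝ) < 1)).mul_left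
      (1 / 3 : ℝ)
    rwa [show (1 / 3 : ℝ) * (1 - 1 / 3)⁻¹ = 1 / 2 by norm_num] at this
  rw [cantorPoint, signSeries, ← tsum_mul_left, ← hg.tsum_eq,
    ← Summable.tsum_add ((summable_signSeries (by norm_num) (by norm_num) u).mul_left _)
      hg.summable]
  congr 1
  ext i
  rw [pow_succ]
  split_ifs <;> ring

theorem isCoding_cantorPoint : IsCoding (1 / 3) cantorPoint := by
  have := isCoding_signSeries (ρ := 1 / 3) (by norm_num) (by norm_num) (a := 1 / 3)
    (by norm_num) (1 / 2)
  convert this using 2 with u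
  exact cantorPoint_eq u

theorem range_cantorPoint : range cantorPoint = cantorSet := by
  have key : ∀ u : ℕ → Bool, Real.ofDigits (fun i => cond (u i) (2 : Fin 3) 0) = cantorPoint u := by
    intro u
    unfold Real.ofDigits Real.ofDigitsTerm cantorPoint
    congr 1
    ext i
    cases hu : u i <;> simp [hu]
  ext x
  rw [cantorSet_eq_zero_two_ofDigits]
  constructor
  · rintro ⟨u, rfl⟩
    exact ⟨fun i => cond (u i) 2 0, fun i => by cases hu : u i <;> simp [hu], key u⟩
  · rintro ⟨d, hd, rfl⟩
    refine ⟨fun i => d i = 2, ?_⟩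
    rw [← key]
    congr 1
    ext i
    have := hd i
    generalize d i = e at *
    fin_cases e <;> simp_all

theorem cantorPoint_mem (u : ℕ → Bool) : cantorPoint u ∈ cantorSet :=
  range_cantorPoint ▸ mem_range_self u

theorem cantorPoint_split (u : ℕ → Bool) (k : ℕ) :
    cantorPoint u = cantorLeft (fun i : Fin k => u i)
      + (1 / 3) ^ k * cantorPoint (fun i => u (i + k)) := by
  rw [cantorPoint, ← (summable_cantorPoint u).sum_add_tsum_nat_add k, cantorPoint,
    ← tsum_mul_left, cantorLeft, Finset.sum_range]
  congr 2
  ext i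
  split_ifs <;> ring

/-! ### Coin tossing measure of cylinders -/

/-- The law of a sequence of independent fair coin tosses. -/
noncomputable abbrev coinMeasure : Measure (ℕ → Bool) :=
  Measure.infinitePi fun _ : ℕ => (PMF.uniformOfFintype Bool).toMeasure

theorem coinMeasure_eq_on (T : Finset ℕ) (v : ℕ → Bool) :
    coinMeasure {u | ∀ i ∈ T, u i = v i} = (2⁻¹ : ℝ≥0∞) ^ T.card := by
  have : {u : ℕ → Bool | ∀ i ∈ T, u i = v i} = (T : Set ℕ).pi fun i => {v i} := by
    ext u
    simp [Set.mem_pi]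
  rw [this, Measure.infinitePi_pi _ (fun i _ => measurableSet_singleton _)]
  have h : ∀ b : Bool, (PMF.uniformOfFintype Bool).toMeasure {b} = 2⁻¹ := by
    intro b
    rw [PMF.toMeasure_apply_singleton _ _ (measurableSet_singleton b)]
    simp
  simp [h]

theorem agreeBelow_eq (l : ℕ) (u : ℕ → Bool) :
    {v | AgreeBelow l u v} = {v | ∀ i ∈ Finset.range l, v i = u i} := by
  ext v
  simp [AgreeBelow, eq_comm]

theorem coinMeasure_agreeBelow (l : ℕ) (u : ℕ → Bool) :
    coinMeasure {v | AgreeBelow l u v} = (2⁻¹ : ℝ≥0∞) ^ l := by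
  rw [agreeBelow_eq, coinMeasure_eq_on, Finset.card_range]

theorem agreeBelow_mem_nhds (l : ℕ) (u : ℕ → Bool) : {v | AgreeBelow l u v} ∈ 𝓝 u := by
  rw [agreeBelow_eq]
  change ∀ᶠ v in 𝓝 u, ∀ i ∈ Finset.range l, v i = u i
  rw [eventually_all_finset]
  intro i _
  have : Tendsto (fun v : ℕ → Bool => v i) (𝓝 u) (𝓝 (u i)) := (continuous_apply i).tendsto u
  rw [nhds_discrete Bool, tendsto_pure] at this
  exact this

theorem measurableSet_agreeBelow (l : ℕ) (u : ℕ → Bool) : MeasurableSet {v | AgreeBelow l u v} := by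
  rw [agreeBelow_eq]
  have : {v : ℕ → Bool | ∀ i ∈ Finset.range l, v i = u i}
      = ((Finset.range l : Finset ℕ) : Set ℕ).pi fun i => {u i} := by
    ext
    simp [Set.mem_pi]
  rw [this]
  exact MeasurableSet.pi (Finset.range l).countable_toSet fun i _ => measurableSet_singleton _

/-- For `ρ ^ d = 1 / 2`, the coin measure of a cylinder of length `l` is `(ρ ^ l) ^ d`. -/
theorem two_inv_pow_eq {ρ d : ℝ} (h0 : 0 < ρ) (hd : ρ ^ d = 1 / 2) (l : ℕ) :
    (2⁻¹ : ℝ≥0∞) ^ l = ENNReal.ofReal ((ρ ^ l) ^ d) := by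
  rw [← Real.rpow_natCast ρ l, ← Real.rpow_mul h0.le, mul_comm, Real.rpow_mul h0.le, hd,
    Real.rpow_natCast, ENNReal.ofReal_pow (by norm_num), one_div,
    ENNReal.ofReal_inv_of_pos (by norm_num)]
  simp

/-! ### Frostman's condition and the mass distribution principle for codings -/

namespace IsCoding

variable {ρ : ℝ} {F : (ℕ → Bool) → ℝ}

protected theorem continuous (hF : IsCoding ρ F) (h1 : ρ < 1) : Continuous F := by
  obtain ⟨A, hA, hAF⟩ := hF.upper
  rw [continuous_iff_continuousAt]
  intro u
  rw [ContinuousAt, Metric.tendsto_nhds]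
  intro ε hε
  obtain ⟨l, hl⟩ := exists_pow_lt_of_lt_one (div_pos hε hA) h1
  filter_upwards [agreeBelow_mem_nhds l u] with v hv
  rw [dist_comm, Real.dist_eq]
  refine (hAF u v l hv).trans_lt ?_
  rwa [lt_div_iff₀ hA, mul_comm] at hl

protected theorem measurable (hF : IsCoding ρ F) (h1 : ρ < 1) : Measurable F :=
  (hF.continuous h1).measurable

protected theorem injective (hF : IsCoding ρ F) (h0 : 0 < ρ) : Function.Injective F := by
  obtain ⟨B, hB, hBF⟩ := hF.lower
  intro u v huv
  ext i
  refine hBF u v (i + 1) ?_ i i.lt_succ_self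
  rw [huv, sub_self, abs_zero]
  positivity

/-- Frostman's condition for the image of a measure under a coding. -/
theorem map_le_ediam (hF : IsCoding ρ F) (h0 : 0 < ρ) (h1 : ρ < 1) (κ : Measure (ℕ → Bool))
    [IsProbabilityMeasure κ] {t C : ℝ} (ht : 0 < t)
    (hκ : ∀ u l, κ {v | AgreeBelow l u v} ≤ ENNReal.ofReal (C * (ρ ^ l) ^ t)) :
    ∃ C' : ℝ, 0 < C' ∧ ∀ S : Set ℝ,
      κ.map F S ≤ ENNReal.ofReal C' * Metric.ediam S ^ t := by
  obtain ⟨B, hB, hBF⟩ := hF.lower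
  -- With `ρ^(l+1) < 2 diam S / B ≤ ρ^l`, the factor 2 gives the strict inequality `diam S < B ρ^l`,
  -- so the preimage lies in one cylinder of length `l`, while `ρ^l < 2 diam S / (B ρ)`. The maximum
  -- with 1 serves sets too large for such an `l`, whose mass is bounded by 1.
  have hC' : 0 < max C 1 * (2 / (B * ρ)) ^ t := by positivity
  refine ⟨max C 1 * (2 / (B * ρ)) ^ t, hC', fun S => ?_⟩
  rcases eq_or_ne (Metric.ediam S) ⊤ with htop | hfin
  · rw [htop, ENNReal.top_rpow_of_pos ht, ENNReal.mul_top (by simpa using hC')]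
    exact le_top
  -- `S` is arbitrary; its closure is measurable and has the same diameter.
  refine (measure_mono subset_closure).trans ?_
  rw [Measure.map_apply (hF.measurable h1) isClosed_closure.measurableSet]
  rcases (F ⁻¹' closure S).eq_empty_or_nonempty with he | ⟨u, hu⟩
  · simp [he]
  have hsub : ∀ l : ℕ, (Metric.ediam S).toReal < B * ρ ^ l →
      κ (F ⁻¹' closure S) ≤ ENNReal.ofReal (C * (ρ ^ l) ^ t) := by
    intro l hl
    refine (measure_mono fun v hv => ?_).trans (hκ u l)
    refine hBF u v l (lt_of_le_of_lt ?_ hl)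
    rw [← Real.dist_eq, dist_edist]
    refine ENNReal.toReal_mono hfin ?_
    rw [← Metric.ediam_closure]
    exact Metric.edist_le_ediam_of_mem hu hv
  obtain ⟨δ, hδ0, hδ⟩ : ∃ δ : ℝ, 0 ≤ δ ∧ Metric.ediam S = ENNReal.ofReal δ :=
    ⟨_, ENNReal.toReal_nonneg, (ENNReal.ofReal_toReal hfin).symm⟩
  rw [hδ, ENNReal.toReal_ofReal hδ0] at hsub
  rw [hδ, ENNReal.ofReal_rpow_of_nonneg hδ0 ht.le, ← ENNReal.ofReal_mul hC'.le, mul_assoc,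
    ← Real.mul_rpow (by positivity) hδ0]
  have hexp : 2 / (B * ρ) * δ = 2 * δ / B / ρ := by field_simp
  rcases hδ0.eq_or_lt with rfl | hpos
  · rw [mul_zero, Real.zero_rpow ht.ne', mul_zero, ENNReal.ofReal_zero]
    refine ge_of_tendsto' (x := atTop) (f := fun l : ℕ => ENNReal.ofReal (C * (ρ ^ l) ^ t)) ?_
      fun l => hsub l (by positivity)
    have h := ((tendsto_pow_atTop_nhds_zero_of_lt_one h0.le h1).rpow_const
      (p := t) (Or.inr ht.le)).const_mul C
    rw [Real.zero_rpow ht.ne', mul_zero] at h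
    simpa using ENNReal.tendsto_ofReal h
  rw [hexp]
  rcases le_or_gt (2 * δ / B) 1 with hle | hgt
  · obtain ⟨l, hl1, hl2⟩ := exists_nat_pow_near_of_lt_one (by positivity) hle h0 h1
    refine (hsub l ?_).trans (ENNReal.ofReal_le_ofReal ?_)
    · rw [div_le_iff₀ hB] at hl2
      linarith
    · gcongr
      · exact le_max_left _ _
      · rw [le_div_iff₀ h0, ← pow_succ]
        exact hl1.le
  · refine prob_le_one.trans ?_
    rw [← ENNReal.ofReal_one]
    refine ENNReal.ofReal_le_ofReal ?_
    have h2 : 1 ≤ 2 * δ / B / ρ := by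
      rw [le_div_iff₀ h0]
      linarith
    calc (1 : ℝ) = 1 * 1 := by norm_num
      _ ≤ _ := mul_le_mul (le_max_right _ _) (Real.one_le_rpow h2 ht.le) zero_le_one (by positivity)

/-- Mass distribution principle for the image of a measure under a coding. -/
theorem le_dimH (hF : IsCoding ρ F) (h0 : 0 < ρ) (h1 : ρ < 1) (κ : Measure (ℕ → Bool))
    [IsProbabilityMeasure κ] {t C : ℝ} (ht : 0 < t)
    (hκ : ∀ u l, κ {v | AgreeBelow l u v} ≤ ENNReal.ofReal (C * (ρ ^ l) ^ t))
    {E : Set ℝ} (hE : MeasurableSet E) (h : ∀ᵐ u ∂κ, F u ∈ E) :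
    ENNReal.ofReal t ≤ dimH E := by
  obtain ⟨C', hC', hle⟩ := hF.map_le_ediam h0 h1 κ ht hκ
  have hC0 : ENNReal.ofReal C' ≠ 0 := by simpa using hC'
  have key : (ENNReal.ofReal C')⁻¹ • κ.map F ≤ Measure.hausdorffMeasure t := by
    refine Measure.le_hausdorffMeasure t _ 1 one_pos fun S _ => ?_
    rw [Measure.smul_apply, smul_eq_mul, mul_comm, ← div_eq_mul_inv]
    exact ENNReal.div_le_of_le_mul' (hle S)
  refine le_dimH_of_hausdorffMeasure_ne_zero (d := t.toNNReal) ?_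
  rw [Real.coe_toNNReal _ ht.le]
  refine (lt_of_lt_of_le ?_ (key E)).ne'
  rw [Measure.smul_apply, smul_eq_mul, Measure.map_apply (hF.measurable h1) hE,
    show κ (F ⁻¹' E) = 1 from (mem_ae_iff_prob_eq_one (hF.measurable h1 hE)).1 h]
  simp

end IsCoding

/-! ### Regularity of the uniform measure and box dimension of a coded set -/

namespace IsCoding

variable {ρ : ℝ} {F : (ℕ → Bool) → ℝ}

theorem coinMeasure_map_le (hF : IsCoding ρ F) (h0 : 0 < ρ) (h1 : ρ < 1) {d : ℝ} (hd0 : 0 < d)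
    (hd : ρ ^ d = 1 / 2) : ∃ C : ℝ, 0 < C ∧ ∀ S : Set ℝ,
      coinMeasure.map F S ≤ ENNReal.ofReal C * Metric.ediam S ^ d :=
  hF.map_le_ediam h0 h1 coinMeasure hd0 (C := 1) fun u l => by
    rw [coinMeasure_agreeBelow, one_mul, two_inv_pow_eq h0 hd]

theorem le_dimH_range (hF : IsCoding ρ F) (h0 : 0 < ρ) (h1 : ρ < 1) {d : ℝ} (hd0 : 0 < d)
    (hd : ρ ^ d = 1 / 2) : ENNReal.ofReal d ≤ dimH (range F) :=
  hF.le_dimH h0 h1 coinMeasure hd0 (C := 1)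
    (fun u l => by rw [coinMeasure_agreeBelow, one_mul, two_inv_pow_eq h0 hd])
    (isCompact_range (hF.continuous h1)).isClosed.measurableSet
    (ae_of_all _ fun u => mem_range_self u)

theorem le_coinMeasure_map_ball (hF : IsCoding ρ F) (h0 : 0 < ρ) (h1 : ρ < 1) {d : ℝ}
    (hd0 : 0 < d) (hd : ρ ^ d = 1 / 2) : ∃ c : ℝ, 0 < c ∧ ∀ u, ∀ r : ℝ, 0 < r → r ≤ 1 →
      ENNReal.ofReal (c * r ^ d) ≤ coinMeasure.map F (Metric.ball (F u) r) := by
  obtain ⟨A, hA, hAF⟩ := hF.upper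
  refine ⟨(ρ / (A + 1)) ^ d, by positivity, fun u r hr hr1 => ?_⟩
  -- Dividing by `A + 1` instead of `A` keeps the quotient at most 1 and puts the cylinder of length
  -- `l + 1` strictly inside the ball.
  obtain ⟨l, hl1, hl2⟩ := exists_nat_pow_near_of_lt_one (x := r / (A + 1)) (by positivity)
    (by rw [div_le_one₀] <;> linarith) h0 h1
  rw [Measure.map_apply (hF.measurable h1) Metric.isOpen_ball.measurableSet]
  calc ENNReal.ofReal ((ρ / (A + 1)) ^ d * r ^ d)
      ≤ ENNReal.ofReal ((ρ ^ (l + 1)) ^ d) := by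
        rw [← Real.mul_rpow (by positivity) hr.le, div_mul_eq_mul_div, mul_div_assoc, pow_succ']
        gcongr
    _ = coinMeasure {v | AgreeBelow (l + 1) u v} := by
        rw [coinMeasure_agreeBelow, two_inv_pow_eq h0 hd]
    _ ≤ _ := by
        refine measure_mono fun v hv => ?_
        rw [mem_preimage, Metric.mem_ball, dist_comm, Real.dist_eq]
        refine (hAF u v _ hv).trans_lt ?_
        rw [lt_div_iff₀ (by linarith)] at hl1
        nlinarith [pow_pos h0 (l + 1)]

theorem support_map (hF : IsCoding ρ F) (h1 : ρ < 1) :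
    (coinMeasure.map F).support = range F := by
  have hm := hF.measurable h1
  refine Subset.antisymm (Measure.support_subset_of_isClosed
    (isCompact_range (hF.continuous h1)).isClosed ?_) ?_
  · rw [mem_ae_map_iff hm.aemeasurable
      (isCompact_range (hF.continuous h1)).isClosed.measurableSet]
    exact univ_mem' fun u => mem_range_self u
  · rintro _ ⟨u, rfl⟩
    rw [Metric.nhds_basis_ball.mem_measureSupport]
    intro r hr
    rw [Measure.map_apply hm Metric.isOpen_ball.measurableSet]
    obtain ⟨A, hA, hAF⟩ := hF.upper
    obtain ⟨l, hl⟩ := exists_pow_lt_of_lt_one (div_pos hr hA) h1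
    refine lt_of_lt_of_le ?_ (measure_mono (s := {v | AgreeBelow l u v}) fun v hv => ?_)
    · rw [coinMeasure_agreeBelow]
      exact ENNReal.pow_pos (by simp) l
    · rw [mem_preimage, Metric.mem_ball, dist_comm, Real.dist_eq]
      refine (hAF u v l hv).trans_lt ?_
      rwa [lt_div_iff₀ hA, mul_comm] at hl

/-- One point from each cylinder of length `l` is an `A ρ^l`-net. -/
theorem externalCoveringNumber_range_le (hF : IsCoding ρ F) : ∃ A : ℝ, 0 < A ∧
    ∀ (l : ℕ) (r : ℝ≥0), A * ρ ^ l ≤ r →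
      Metric.externalCoveringNumber r (range F) ≤ (2 ^ l : ℕ) := by
  obtain ⟨A, hA, hAF⟩ := hF.upper
  refine ⟨A, hA, fun l r hr => ?_⟩
  let e : (Fin l → Bool) → (ℕ → Bool) := fun w i => if h : i < l then w ⟨i, h⟩ else false
  have hc : Metric.IsCover r (range F) (range (F ∘ e)) := by
    rintro _ ⟨u, rfl⟩
    refine ⟨_, ⟨fun i => u i, rfl⟩, ?_⟩
    change edist _ _ ≤ _
    rw [edist_dist, ENNReal.ofReal_le_iff_le_toReal (by simp), ENNReal.coe_toReal, Real.dist_eq]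
    refine (hAF _ _ l fun i hi => ?_).trans hr
    simp [e, hi]
  refine hc.externalCoveringNumber_le_encard.trans ?_
  rw [← image_univ]
  refine (encard_image_le _ _).trans ?_
  simp [encard_univ]

theorem upperBoxDim_range_le (hF : IsCoding ρ F) (h0 : 0 < ρ) (h1 : ρ < 1) {d : ℝ}
    (hd0 : 0 < d) (hd : ρ ^ d = 1 / 2) : upperBoxDim (range F) ≤ (d : EReal) := by
  obtain ⟨A, hA, hN⟩ := hF.externalCoveringNumber_range_le
  -- For `ρ^(l+1) < r/A ≤ ρ^l` the cover has `2^(l+1) = (ρ^(l+1))^(-d) ≤ K r^(-d)` balls; `log K`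
  -- disappears after division by `-log r`.
  set K : ℝ := (A / ρ) ^ d with hK
  have hK0 : 0 < K := by positivity
  have hlim : Tendsto (fun r : ℝ≥0 => (((Real.log K / (-Real.log r) + d : ℝ)) : EReal))
      (𝓝[>] 0) (𝓝 (d : EReal)) := by
    refine (continuous_coe_real_ereal.tendsto d).comp ?_
    have h2 : Tendsto (fun r : ℝ≥0 => (r : ℝ)) (𝓝[>] 0) (𝓝[>] 0) := by
      refine tendsto_nhdsWithin_iff.2 ⟨?_, ?_⟩
      · exact (NNReal.continuous_coe.tendsto 0).mono_left nhdsWithin_le_nhds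
      · filter_upwards [self_mem_nhdsWithin] with r hr
        exact NNReal.coe_pos.2 hr
    have h3 := tendsto_neg_atBot_atTop.comp (Real.tendsto_log_nhdsGT_zero.comp h2)
    simpa using (h3.const_div_atTop (Real.log K)).add_const d
  rw [upperBoxDim, ← hlim.limsup_eq]
  refine limsup_le_limsup ?_
  have hs : min 1 A.toNNReal > 0 := by simp [hA]
  filter_upwards [Ioo_mem_nhdsGT hs] with r hr
  have hr0 : (0 : ℝ) < r := NNReal.coe_pos.2 hr.1
  have hr1 : (r : ℝ) < 1 := by exact_mod_cast hr.2.trans_le (min_le_left _ _)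
  have hrA : (r : ℝ) < A := by
    have : (r : ℝ) < (A.toNNReal : ℝ) := by exact_mod_cast hr.2.trans_le (min_le_right _ _)
    rwa [Real.coe_toNNReal _ hA.le] at this
  have hlog : 0 < -Real.log r := by linarith [Real.log_neg hr0 hr1]
  obtain ⟨l, hl1, hl2⟩ := exists_nat_pow_near_of_lt_one (x := r / A) (by positivity)
    (by rw [div_le_one₀] <;> linarith) h0 h1
  have hnum : ENNReal.log (Metric.externalCoveringNumber r (range F) : ℝ≥0∞) ≤
      ((Real.log K + d * (-Real.log r) : ℝ) : EReal) := by
    have h4 : (Metric.externalCoveringNumber r (range F) : ℝ≥0∞) ≤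
        ENNReal.ofReal (K * (r : ℝ) ^ (-d)) := by
      refine (ENat.toENNReal_mono (hN (l + 1) r ?_)).trans ?_
      · rw [lt_div_iff₀ hA, mul_comm] at hl1
        exact hl1.le
      · have h5 : (((2 ^ (l + 1) : ℕ) : ℕ∞) : ℝ≥0∞) = ENNReal.ofReal (2 ^ (l + 1)) := by
          rw [ENNReal.ofReal_pow (by norm_num)]
          simp
        rw [h5]
        refine ENNReal.ofReal_le_ofReal ?_
        have h6 : (2 : ℝ) ^ (l + 1) = ((ρ ^ (l + 1)) ^ d)⁻¹ := by
          rw [← Real.rpow_natCast ρ, ← Real.rpow_mul h0.le, mul_comm, Real.rpow_mul h0.le, hd,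
            Real.rpow_natCast, one_div, inv_pow, inv_inv]
        rw [h6, Real.rpow_neg hr0.le, hK, ← div_eq_mul_inv, ← Real.div_rpow (by positivity) hr0.le,
          ← Real.inv_rpow (by positivity)]
        refine Real.rpow_le_rpow (by positivity) ?_ hd0.le
        rw [inv_le_comm₀ (by positivity) (by positivity), inv_div, div_div_eq_mul_div, pow_succ,
          mul_div_right_comm]
        gcongr
    refine (ENNReal.log_monotone h4).trans ?_
    rw [ENNReal.log_ofReal_of_pos (by positivity), Real.log_mul hK0.ne' (by positivity),
      Real.log_rpow hr0]
    exact_mod_cast le_of_eq (by ring)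
  refine (EReal.div_le_div_right_of_nonneg (by exact_mod_cast hlog.le) hnum).trans ?_
  rw [← EReal.coe_div]
  exact EReal.coe_le_coe_iff.2 (by rw [add_div, mul_div_cancel_right₀ _ hlog.ne'])

end IsCoding

/-! ### Hausdorff dimension of limsup sets, box dimension and packing dimension -/

section Covers

variable {X : Type*} [MetricSpace X]

/-- The limsup set of a sequence of sets with `∑ diam ^ t < ∞` has Hausdorff dimension
at most `t`. -/
theorem dimH_limsup_le {A : ℕ → Set X} {t : ℝ} (ht : 0 < t)
    (h : ∑' n, Metric.ediam (A n) ^ t ≠ ⊤) :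
    dimH (⋂ k : ℕ, ⋃ n : ℕ, ⋃ _ : k ≤ n, A n) ≤ ENNReal.ofReal t := by
  borelize X
  have hlim := ENNReal.tendsto_sum_nat_add _ h
  have hlim' : Tendsto (fun n => (∑' i, Metric.ediam (A (i + n)) ^ t) ^ t⁻¹) atTop (𝓝 0) := by
    have := hlim.ennrpow_const t⁻¹
    rwa [ENNReal.zero_rpow_of_pos (inv_pos.2 ht)] at this
  have key : Measure.hausdorffMeasure t (⋂ k : ℕ, ⋃ n : ℕ, ⋃ _ : k ≤ n, A n) ≤ 0 := by
    rw [← hlim.liminf_eq]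
    refine Measure.hausdorffMeasure_le_liminf_tsum t _ _ hlim' (fun n i => A (i + n))
      (Eventually.of_forall fun n i => ?_) (Eventually.of_forall fun n x hx => ?_)
    · rw [ENNReal.le_rpow_inv_iff ht]
      exact ENNReal.le_tsum (f := fun i => Metric.ediam (A (i + n)) ^ t) i
    · obtain ⟨m, hm⟩ := mem_iUnion.1 (mem_iInter.1 hx n)
      obtain ⟨hnm, hx⟩ := mem_iUnion.1 hm
      exact mem_iUnion.2 ⟨m - n, by rwa [Nat.sub_add_cancel hnm]⟩
  refine dimH_le_of_hausdorffMeasure_ne_top (d := t.toNNReal) ?_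
  rw [Real.coe_toNNReal _ ht.le]
  exact (key.trans_lt ENNReal.zero_lt_top).ne

theorem exists_finset_cover_of_le {A : Set X} {r : ℝ≥0} {x : ℝ}
    (h : (Metric.externalCoveringNumber r A : ℝ≥0∞) ≤ ENNReal.ofReal x) :
    ∃ T : Finset X, A ⊆ ⋃ y ∈ T, Metric.closedBall y r ∧ (T.card : ℝ≥0∞) ≤ ENNReal.ofReal x := by
  have hne : Metric.externalCoveringNumber r A ≠ ⊤ := by
    intro htop
    rw [htop] at h
    simp at h
  obtain ⟨n, hn⟩ := ENat.ne_top_iff_exists.1 hne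
  have hlt : Metric.externalCoveringNumber r A < (n + 1 : ℕ) := by
    rw [← hn]
    exact_mod_cast n.lt_succ_self
  rw [Metric.externalCoveringNumber] at hlt
  obtain ⟨C, hC⟩ := iInf_lt_iff.1 hlt
  obtain ⟨hcov, hC⟩ := iInf_lt_iff.1 hC
  have hfin : C.Finite := by
    rw [← encard_lt_top_iff]
    exact hC.trans (ENat.natCast_lt_top _)
  refine ⟨hfin.toFinset, by simpa using hcov.subset_iUnion_closedBall, le_trans ?_ h⟩
  rw [← hn]
  rw [hfin.encard_eq_coe_toFinset_card] at hC
  have : hfin.toFinset.card < n + 1 := by exact_mod_cast hC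
  simpa using Nat.lt_succ_iff.1 this

/-- For `t < w < u`, eventually at most `r^(-w)` balls of radius `r` cover `A`. Their `u`-sum is at
most `2^u r^(u-w)`, which tends to 0, so the `u`-dimensional Hausdorff measure vanishes. -/
theorem dimH_le_of_upperBoxDim_le {A : Set X} {t : ℝ≥0∞} (h : upperBoxDim A ≤ (t : EReal)) :
    dimH A ≤ t := by
  borelize X
  refine le_of_forall_gt_imp_ge_of_dense fun u htu => ?_
  rcases eq_or_ne u ⊤ with rfl | hu
  · exact le_top
  lift u to ℝ≥0 using hu
  obtain ⟨w, htw, hwu⟩ := exists_between htu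
  lift w to ℝ≥0 using (hwu.trans ENNReal.coe_lt_top).ne
  have hwu' : (w : ℝ) < u := by exact_mod_cast hwu
  have hev := eventually_lt_of_limsup_lt (lt_of_le_of_lt h (EReal.coe_ennreal_lt_coe_ennreal_iff.2 htw))
  have hT : ∀ᶠ r : ℝ≥0 in 𝓝[>] 0, ∃ T : Finset X, A ⊆ ⋃ y ∈ T, Metric.closedBall y r ∧
      (T.card : ℝ≥0∞) ≤ ENNReal.ofReal ((r : ℝ) ^ (-(w : ℝ))) := by
    filter_upwards [hev, Ioo_mem_nhdsGT one_pos] with r hr hr1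
    have hr0 : (0 : ℝ) < r := NNReal.coe_pos.2 hr1.1
    have hlog : 0 < -Real.log r := by
      linarith [Real.log_neg hr0 (by exact_mod_cast hr1.2 : (r : ℝ) < 1)]
    refine exists_finset_cover_of_le ?_
    rw [← ENNReal.log_le_log_iff, ENNReal.log_ofReal_of_pos (by positivity), Real.log_rpow hr0]
    have := (EReal.div_le_iff_le_mul (by exact_mod_cast hlog) (EReal.coe_ne_top _)).1 hr.le
    refine this.trans (le_of_eq ?_)
    rw [show ((w : ℝ≥0∞) : EReal) = ((w : ℝ) : EReal) from rfl, ← EReal.coe_mul]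
    congr 1
    ring
  obtain ⟨T, hT⟩ := hT.choice
  have hr : Tendsto (fun r : ℝ≥0 => 2 * (r : ℝ≥0∞)) (𝓝[>] 0) (𝓝 0) := by
    have : Tendsto (fun r : ℝ≥0 => 2 * (r : ℝ≥0∞)) (𝓝 0) (𝓝 (2 * ((0 : ℝ≥0) : ℝ≥0∞))) :=
      ENNReal.Tendsto.const_mul (ENNReal.continuous_coe.tendsto 0) (Or.inr (by simp))
    simpa using this.mono_left nhdsWithin_le_nhds
  have hdiam : ∀ (r : ℝ≥0) (y : X), Metric.ediam (Metric.closedBall y r) ≤ 2 * (r : ℝ≥0∞) := by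
    intro r y
    rw [← Metric.closedEBall_coe]
    exact Metric.ediam_closedEBall_le
  have hbound : Tendsto (fun r : ℝ≥0 =>
      ENNReal.ofReal (2 ^ (u : ℝ) * (r : ℝ) ^ ((u : ℝ) - w))) (𝓝[>] 0) (𝓝 0) := by
    have h1 : Tendsto (fun r : ℝ≥0 => (2 ^ (u : ℝ) * (r : ℝ) ^ ((u : ℝ) - w))) (𝓝 0)
        (𝓝 (2 ^ (u : ℝ) * ((0 : ℝ≥0) : ℝ) ^ ((u : ℝ) - w))) :=
      ((NNReal.continuous_coe.tendsto 0).rpow_const (Or.inr (by linarith))).const_mul _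
    rw [NNReal.coe_zero, Real.zero_rpow (by linarith), mul_zero] at h1
    simpa using ENNReal.tendsto_ofReal (h1.mono_left nhdsWithin_le_nhds)
  have key : Measure.hausdorffMeasure (u : ℝ) A ≤ 0 := by
    refine (Measure.hausdorffMeasure_le_liminf_sum (u : ℝ) A _ hr
      (fun r (y : T r) => Metric.closedBall (y : X) r) (Eventually.of_forall fun r y => hdiam r y)
      (hT.mono fun r h => ?_)).trans ?_
    · simpa [iUnion_subtype] using h.1
    rw [← hbound.liminf_eq]
    refine liminf_le_liminf ?_
    filter_upwards [hT, self_mem_nhdsWithin] with r h hr0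
    have hr0 : (0 : ℝ) < r := NNReal.coe_pos.2 hr0
    calc ∑ y : T r, Metric.ediam (Metric.closedBall (y : X) r) ^ (u : ℝ)
        ≤ ∑ _y : T r, (2 * (r : ℝ≥0∞)) ^ (u : ℝ) :=
          Finset.sum_le_sum fun y _ => ENNReal.rpow_le_rpow (hdiam r y) u.2
      _ = (T r).card * (2 * (r : ℝ≥0∞)) ^ (u : ℝ) := by simp
      _ ≤ ENNReal.ofReal ((r : ℝ) ^ (-(w : ℝ))) * (2 * (r : ℝ≥0∞)) ^ (u : ℝ) := by
          gcongr
          exact h.2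
      _ = _ := by
          rw [show (2 * (r : ℝ≥0∞)) = ENNReal.ofReal (2 * r) by
            rw [ENNReal.ofReal_mul (by norm_num)]; simp,
            ENNReal.ofReal_rpow_of_nonneg (by positivity) u.coe_nonneg,
            ← ENNReal.ofReal_mul (by positivity), Real.mul_rpow (by norm_num) hr0.le,
            mul_left_comm, ← Real.rpow_add hr0, neg_add_eq_sub]
  exact dimH_le_of_hausdorffMeasure_ne_top (key.trans_lt ENNReal.zero_lt_top).ne

theorem dimH_le_packingDim (S : Set X) : dimH S ≤ packingDim S := by
  refine le_sInf ?_
  rintro t ⟨A, hA, hS⟩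
  refine (dimH_mono hS).trans ?_
  rw [dimH_iUnion]
  exact iSup_le fun i => dimH_le_of_upperBoxDim_le (hA i)

end Covers

/-! ### Measures on the tree that follow prescribed words on sparse blocks -/

/-- Prescribe the coordinates outside `free` by a rule that depends on the earlier coordinates. -/
theorem exists_fill (free : Set ℕ) (val : ℕ → (ℕ → Bool) → Bool)
    (hval : ∀ i ∉ free, ∀ u v, AgreeBelow i u v → val i u = val i v) :
    ∃ g : (ℕ → Bool) → (ℕ → Bool), Measurable g ∧
      ∀ σ i, (i ∈ free → g σ i = σ i) ∧ (i ∉ free → g σ i = val i (g σ)) := by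
  classical
  -- `G n σ` has its first `n` coordinates filled in. Coordinate `i` never changes after stage `i +
  -- 1`, so the diagonal `G (i + 1) σ i` is the result.
  let G : ℕ → (ℕ → Bool) → (ℕ → Bool) := fun n => Nat.rec (fun _ _ => false)
    (fun n Gn σ => Function.update (Gn σ) n (if n ∈ free then σ n else val n (Gn σ))) n
  have hG : ∀ n σ, G (n + 1) σ =
      Function.update (G n σ) n (if n ∈ free then σ n else val n (G n σ)) := fun _ _ => rfl
  have hstab : ∀ σ i n, i < n → G n σ i = G (i + 1) σ i := by
    intro σ i n hn
    induction n, hn using Nat.le_induction with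
    | base => rfl
    | succ n hn ih => rw [hG, Function.update_of_ne (by lia), ih]
  have hagree : ∀ σ n, AgreeBelow n (G n σ) (fun i => G (i + 1) σ i) :=
    fun σ n i hi => hstab σ i n hi
  -- Depending on finitely many coordinates, the rule is locally constant.
  have hvalm : ∀ i ∉ free, Measurable (val i) := fun i hi => by
    refine Continuous.measurable (continuous_iff_continuousAt.2 fun u => ?_)
    refine tendsto_const_nhds.congr' ?_
    filter_upwards [agreeBelow_mem_nhds i u] with v hv using hval i hi u v hv
  have hGm : ∀ n, Measurable (G n) := by
    intro n
    induction n with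
    | zero => exact measurable_const
    | succ n ih =>
      refine measurable_pi_iff.2 fun i => ?_
      simp only [hG, Function.update_apply]
      split_ifs with _ hn
      · exact measurable_pi_apply n
      · exact (hvalm n hn).comp ih
      · exact (measurable_pi_apply i).comp ih
  refine ⟨fun σ i => G (i + 1) σ i,
    measurable_pi_iff.2 fun i => (measurable_pi_apply i).comp (hGm (i + 1)),
    fun σ i => ⟨fun hi => ?_, fun hi => ?_⟩⟩
  · simp [hG, hi]
  · change G (i + 1) σ i = _
    rw [hG, Function.update_self, if_neg hi]
    exact hval i hi _ _ (hagree σ i)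

/-- The number of free positions below `l`, when the forced positions form the blocks
`[k j, m j)`. -/
theorem le_card_free {k m p : ℕ → ℕ} {N : ℕ} {θ a : ℝ} (hN : 0 < N) (ha : 0 ≤ a) (ha1 : a ≤ 1)
    (hθ : a * θ ≤ 1 - 1 / N) (hm : ∀ j, (m j : ℝ) ≤ θ * k j + 1) (hkm : ∀ j, k j ≤ m j)
    (hk : StrictMono k) (hp : ∀ j, p (j + 1) = m j) (hpk : ∀ j, N * p j ≤ k j)
    (hpm : Monotone p) (l : ℕ) (S : Finset ℕ)
    (hS : ∀ i < l, (∀ j, k j ≤ i → m j ≤ i) → i ∈ S) : a * l - 1 ≤ S.card := by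
  by_cases hl : l < k 0
  · have : Finset.range l ⊆ S := fun i hi => by
      have hi := Finset.mem_range.1 hi
      exact hS i hi fun j hj => by
        have := hk.monotone (Nat.zero_le j)
        lia
    have hc := Finset.card_le_card this
    rw [Finset.card_range] at hc
    have hc : (l : ℝ) ≤ S.card := by exact_mod_cast hc
    have : (0 : ℝ) ≤ l := by positivity
    nlinarith
  push Not at hl
  obtain ⟨j, hj1, hj2⟩ : ∃ j, k j ≤ l ∧ l < k (j + 1) := by
    classical
    have hex : ∃ j, l < k j := ⟨l + 1, hk.id_le (l + 1)⟩
    have h0 : Nat.find hex ≠ 0 := fun h => by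
      have := Nat.find_spec hex
      rw [h] at this
      lia
    obtain ⟨j, hj⟩ := Nat.exists_eq_succ_of_ne_zero h0
    refine ⟨j, not_lt.1 (Nat.find_min hex (by lia)), ?_⟩
    have := Nat.find_spec hex
    rwa [hj] at this
  -- Positions before `p j` are discarded, at a cost of at most `k j / N`. The remaining `k j - p j
  -- ≥ (1 - 1/N) k j ≥ a θ k j ≥ a (m j - 1)` free positions pay for the block `[k j, m j)`; each
  -- later position pays for itself since `a ≤ 1`.
  have hsub : Finset.Ico (p j) (k j) ∪ Finset.Ico (m j) l ⊆ S := by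
    intro i hi
    rw [Finset.mem_union, Finset.mem_Ico, Finset.mem_Ico] at hi
    rcases hi with ⟨h1, h2⟩ | ⟨h1, h2⟩
    · refine hS i (by lia) fun j' hj' => ?_
      have hlt : j' < j := hk.lt_iff_lt.1 (by lia)
      have := hpm (Nat.succ_le_of_lt hlt)
      rw [Nat.succ_eq_add_one, hp] at this
      lia
    · refine hS i h2 fun j' hj' => ?_
      have hlt : j' < j + 1 := hk.lt_iff_lt.1 (by lia)
      have := hpm (Nat.succ_le_of_lt hlt)
      rw [Nat.succ_eq_add_one, hp, hp] at this
      lia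
  have hc := Finset.card_le_card hsub
  have hkmj := hkm j
  rw [Finset.card_union_of_disjoint, Nat.card_Ico, Nat.card_Ico] at hc
  swap
  · rw [Finset.disjoint_left]
    intro i h1 h2
    rw [Finset.mem_Ico] at h1 h2
    lia
  have hNr : (0 : ℝ) < N := by exact_mod_cast hN
  have hpj : (p j : ℝ) ≤ k j / N := by
    rw [le_div_iff₀ hNr, mul_comm]
    exact_mod_cast hpk j
  have hpj' : p j ≤ k j := le_trans (Nat.le_mul_of_pos_left _ hN) (hpk j)
  have hc : ((k j : ℝ) - p j) + ((l - m j : ℕ) : ℝ) ≤ S.card := by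
    rw [← Nat.cast_sub hpj']
    exact_mod_cast hc
  have hkj : (0 : ℝ) ≤ k j := by positivity
  have h3 : (a * θ) * k j ≤ (1 - 1 / N) * k j := by gcongr
  have h4 : (1 - 1 / (N : ℝ)) * k j = k j - k j / N := by ring
  have h5 : a * m j ≤ a * (θ * k j + 1) := by gcongr; exact hm j
  have h6 : (l : ℝ) ≤ m j + (l - m j : ℕ) := by exact_mod_cast (by lia : l ≤ m j + (l - m j))
  have h7 : a * l ≤ a * (m j + (l - m j : ℕ)) := by gcongr
  have h8 : (0 : ℝ) ≤ (l - m j : ℕ) := by positivity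
  nlinarith

/-- If every long enough cylinder `[w]`, `|w| = k`, contains a cylinder of length `M k ≈ θ k`
with the property `Hit j`, for every `j`, then a measure of dimension `a < 1 / θ` lives on the
sequences that have every property `Hit j`. -/
theorem exists_measure_of_hit {Hit : ℕ → ℕ → (ℕ → Bool) → Prop}
    (hHit : ∀ j m u v, AgreeBelow m u v → Hit j m u → Hit j m v) {M : ℕ → ℕ} {θ a : ℝ}
    (hM : ∀ k, (M k : ℝ) ≤ θ * k + 1) (hkM : ∀ k, k ≤ M k) (ha : 0 ≤ a) (ha1 : a ≤ 1)
    (haθ : a * θ < 1)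
    (h : ∀ j, ∃ K, ∀ k ≥ K, ∀ w, ∃ u, AgreeBelow k w u ∧ Hit j (M k) u) :
    ∃ κ : Measure (ℕ → Bool), IsProbabilityMeasure κ ∧
      (∀ u l, κ {v | AgreeBelow l u v} ≤ ENNReal.ofReal (2 * (1 / 2 : ℝ) ^ (a * l))) ∧
      ∀ᵐ u ∂κ, ∀ j, ∃ m, Hit j m u := by
  classical
  choose K hK using h
  obtain ⟨N, hN⟩ := exists_nat_one_div_lt (show 0 < 1 - a * θ by linarith)
  -- The `j`-th block starts late enough for hits to be available (`K j`) and so late that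
  -- everything up to the end of the previous block is at most the fraction `1/(N+1)`, where
  -- `1/(N+1) < 1 - aθ`.
  let k : ℕ → ℕ := fun j => Nat.rec (K 0 + 1) (fun j kj => max (K (j + 1)) ((N + 1) * M kj) + 1) j
  have hk1 : ∀ j, k (j + 1) = max (K (j + 1)) ((N + 1) * M (k j)) + 1 := fun _ => rfl
  have hkK : ∀ j, K j ≤ k j := by
    rintro (_ | j)
    · exact Nat.le_succ _
    · rw [hk1]
      lia
  have hMk : ∀ j, (N + 1) * M (k j) < k (j + 1) := fun j => by
    rw [hk1]
    lia
  have hMk' : ∀ j, M (k j) < k (j + 1) := fun j =>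
    lt_of_le_of_lt (Nat.le_mul_of_pos_left _ N.succ_pos) (hMk j)
  have hk : StrictMono k := strictMono_nat_of_lt_succ fun j => (hkM (k j)).trans_lt (hMk' j)
  let p : ℕ → ℕ := fun j => Nat.casesOn j 0 fun j => M (k j)
  have hpk : ∀ j, (N + 1) * p j ≤ k j := by
    rintro (_ | j)
    · simp [p]
    · exact (hMk j).le
  have hpm : Monotone p := by
    refine monotone_nat_of_le_succ ?_
    rintro (_ | j)
    · exact Nat.zero_le _
    · exact (hMk' j).le.trans (hkM _)
  have huniq : ∀ i j j', k j ≤ i → i < M (k j) → k j' ≤ i → i < M (k j') → j = j' := by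
    have : ∀ i j j', i < M (k j) → k j' ≤ i → ¬ j < j' := by
      intro i j j' h1 h2 hlt
      have h3 := hk.monotone (Nat.succ_le_of_lt hlt)
      have h4 := hMk' j
      rw [Nat.succ_eq_add_one] at h3
      lia
    intro i j j' h1 h2 h3 h4
    exact le_antisymm (not_lt.1 (this i j' j h4 h1)) (not_lt.1 (this i j j' h2 h3))
  have hext' : ∀ (j : ℕ) (w : ℕ → Bool), ∃ u, AgreeBelow (k j) w u ∧ Hit j (M (k j)) u :=
    fun j w => hK j (k j) (hkK j) w
  choose ext hext using hext'
  obtain ⟨free, hfree⟩ : ∃ free : Set ℕ, ∀ i, i ∈ free ↔ ∀ j, k j ≤ i → M (k j) ≤ i :=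
    ⟨{i | ∀ j, k j ≤ i → M (k j) ≤ i}, fun _ => Iff.rfl⟩
  -- `ext j w` is chosen separately for each infinite word `w`. Truncation makes the choice depend
  -- on the first `k j` coordinates only, as `exists_fill` requires.
  let trunc : ℕ → (ℕ → Bool) → ℕ → Bool := fun (j : ℕ) (u : ℕ → Bool) (n : ℕ) =>
    bif Nat.blt n (k j) then u n else false
  have hJ : ∀ i, ∃ j, i ∉ free → k j ≤ i ∧ i < M (k j) := by
    intro i
    by_cases hi : i ∈ free
    · exact ⟨0, fun h => absurd hi h⟩
    · have hi := mt (hfree i).2 hi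
      push Not at hi
      exact ⟨hi.choose, fun _ => hi.choose_spec⟩
  choose J hJ using hJ
  let val : ℕ → (ℕ → Bool) → Bool := fun i u => ext (J i) (trunc (J i) u) i
  obtain ⟨g, hg, hgv⟩ := exists_fill free val fun i hi u v huv => by
    change ext (J i) (trunc (J i) u) i = ext (J i) (trunc (J i) v) i
    suffices h : trunc (J i) u = trunc (J i) v by rw [h]
    ext n
    change (bif Nat.blt n (k (J i)) then u n else false) = bif Nat.blt n (k (J i)) then v n else false
    by_cases hn : n < k (J i)
    · rw [huv n (hn.trans_le (hJ i hi).1)]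
    · rw [Bool.eq_false_iff.2 (fun h => hn (Nat.blt_eq ▸ h)), cond_false, cond_false]
  refine ⟨coinMeasure.map g, Measure.isProbabilityMeasure_map hg.aemeasurable, fun u l => ?_, ?_⟩
  · rw [Measure.map_apply hg (measurableSet_agreeBelow l u)]
    have hsub : g ⁻¹' {v | AgreeBelow l u v} ⊆
        {σ | ∀ i ∈ (Finset.range l).filter (· ∈ free), σ i = u i} := by
      intro σ hσ i hi
      rw [Finset.mem_filter, Finset.mem_range] at hi
      rw [← (hgv σ i).1 hi.2]
      exact (hσ i hi.1).symm
    refine (measure_mono hsub).trans ?_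
    · rw [coinMeasure_eq_on]
      -- A cylinder of length `l` fixes at least `a l - 1` independent bits; the lost bit is the
      -- factor 2 in the bound.
      have hcard := le_card_free (k := k) (m := fun j => M (k j)) (p := p) (N := N + 1) (θ := θ)
        (a := a) N.succ_pos ha ha1 (by push_cast; linarith) (fun j => hM _) (fun j => hkM _) hk
        (fun _ => rfl) hpk hpm l ((Finset.range l).filter (· ∈ free))
        (fun i hi hf => Finset.mem_filter.2 ⟨Finset.mem_range.2 hi, (hfree i).2 hf⟩)
      generalize ((Finset.range l).filter (· ∈ free)).card = n at *
      rw [show (2⁻¹ : ℝ≥0∞) = ENNReal.ofReal (1 / 2) by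
        rw [one_div, ENNReal.ofReal_inv_of_pos (by norm_num)]; simp,
        ← ENNReal.ofReal_pow (by norm_num)]
      refine ENNReal.ofReal_le_ofReal ?_
      rw [← Real.rpow_natCast]
      calc (1 / 2 : ℝ) ^ (n : ℝ) ≤ (1 / 2 : ℝ) ^ (a * l - 1) :=
            Real.rpow_le_rpow_of_exponent_ge (by norm_num) (by norm_num) hcard
        _ = _ := by
          rw [Real.rpow_sub (by norm_num), Real.rpow_one]
          ring
  · refine (ae_map_iff hg.aemeasurable ?_).2 (ae_of_all _ fun σ j => ?_)
    · rw [show {u | ∀ j, ∃ m, Hit j m u} = ⋂ j, ⋃ m, {u | Hit j m u} by ext; simp]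
      refine MeasurableSet.iInter fun j => MeasurableSet.iUnion fun m => ?_
      refine IsOpen.measurableSet (isOpen_iff_mem_nhds.2 fun u hu => ?_)
      filter_upwards [agreeBelow_mem_nhds m u] with v hv using hHit j m u v hv hu
    · refine ⟨M (k j), hHit _ _ (ext j (trunc j (g σ))) _ (fun i hi => ?_) (hext j _).2⟩
      rcases lt_or_ge i (k j) with hik | hik
      · rw [← (hext j _).1 i hik]
        simp [trunc, hik]
      · have hf : i ∉ free := fun hf => absurd ((hfree i).1 hf j hik) (by lia)
        rw [(hgv σ i).2 hf]
        simp only [val]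
        rw [huniq i _ _ (hJ i hf).1 (hJ i hf).2 hik hi]

/-! ### Hitting probabilities and the random lower bound -/

/-- This absorbs the union bound over the `2^k` words of length `k`: since `k / γ^k` tends to 0, the
exponential is eventually below `4^(-k)`. -/
theorem eventually_two_pow_mul_exp_le {c γ : ℝ} (hc : 0 < c) (hγ : 1 < γ) :
    ∀ᶠ k : ℕ in atTop, (2 : ℝ) ^ k * Real.exp (-(c * γ ^ k)) ≤ (1 / 2) ^ k := by
  have h4 : 0 < Real.log 4 := Real.log_pos (by norm_num)
  have h := tendsto_pow_const_div_const_pow_of_one_lt 1 hγ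
  filter_upwards [h.eventually (ge_mem_nhds (show 0 < c / Real.log 4 by positivity))] with k hk
  have hγk : 0 < γ ^ k := by positivity
  rw [pow_one, div_le_div_iff₀ hγk h4] at hk
  calc (2 : ℝ) ^ k * Real.exp (-(c * γ ^ k)) ≤ 2 ^ k * Real.exp (-(k * Real.log 4)) := by gcongr
    _ = (1 / 2) ^ k := by
      rw [Real.exp_neg, ← Real.log_pow, Real.exp_log (by positivity), ← div_eq_mul_inv,
        show (4 : ℝ) = 2 * 2 by norm_num, mul_pow, one_div_pow]
      field_simp

/-- The number of extensions of a word of length `k` to a word of length `m`. -/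
theorem card_extensions {k m : ℕ} (hkm : k ≤ m) (w : ℕ → Bool) :
    (Finset.univ.filter fun u : Fin m → Bool => ∀ i : Fin m, (i : ℕ) < k → u i = w i).card
      = 2 ^ (m - k) := by
  have : (Finset.univ.filter fun u : Fin m → Bool => ∀ i : Fin m, (i : ℕ) < k → u i = w i)
      = Fintype.piFinset fun i : Fin m => if (i : ℕ) < k then {w i} else Finset.univ := by
    ext u
    rw [Finset.mem_filter, Fintype.mem_piFinset]
    simp only [Finset.mem_univ, true_and]
    refine forall_congr' fun i => ?_
    split_ifs with h <;> simp [h]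
  rw [this, Fintype.card_piFinset]
  calc ∏ i : Fin m, (if (i : ℕ) < k then ({w i} : Finset Bool) else Finset.univ).card
      = ∏ i : Fin m, (fun i : ℕ => if i < k then 1 else 2) i := by
        refine Finset.prod_congr rfl fun i _ => ?_
        dsimp only
        split_ifs <;> simp
    _ = ∏ i ∈ Finset.range m, (if i < k then 1 else 2) :=
        Fin.prod_univ_eq_prod_range (fun i : ℕ => if i < k then 1 else 2) m
    _ = _ := by
        rw [← Finset.prod_range_mul_prod_Ico _ hkm,
          Finset.prod_congr rfl fun i hi => if_pos (Finset.mem_range.1 hi),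
          Finset.prod_congr rfl fun i hi => if_neg (not_lt.2 (Finset.mem_Ico.1 hi).1)]
        simp

/-- Lower bound for the exponent in the probability that a cylinder is missed. -/
theorem eventually_le_expected_hits {ρ d D s c A θ : ℝ} (h0 : 0 < ρ) (h1 : ρ < 1)
    (hd : ρ ^ d = 1 / 2) (hs : 0 < s) (hc : 0 < c) (hA : 0 < A) (hθ : 1 ≤ θ)
    (ht : 0 < s - (D - d)) {M : ℕ → ℕ} (hM : ∀ k, θ * k ≤ M k) (j : ℕ) :
    ∀ᶠ k : ℕ in atTop, c * A ^ (-s) / 2 * (ρ ^ (-((s - (D - d)) * θ)) / 2) ^ k ≤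
      2 ^ (M k - k) * (c * (ρ ^ M k) ^ D) * (⌊(A * ρ ^ M k) ^ (-s)⌋₊ - j : ℕ) := by
  have hkM : ∀ k, k ≤ M k := fun k => by
    have : (k : ℝ) ≤ M k := le_trans (le_mul_of_one_le_left (by positivity) hθ) (hM k)
    exact_mod_cast this
  have hMtop : Tendsto M atTop atTop := tendsto_atTop_mono hkM tendsto_id
  have hpow : Tendsto (fun k => (ρ ^ M k)) atTop (𝓝[>] 0) := by
    refine tendsto_nhdsWithin_iff.2
      ⟨(tendsto_pow_atTop_nhds_zero_of_lt_one h0.le h1).comp hMtop,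
        Eventually.of_forall fun k => pow_pos h0 _⟩
  have hlarge : Tendsto (fun k => (ρ ^ M k) ^ (-s)) atTop atTop :=
    (tendsto_rpow_neg_nhdsGT_zero (by linarith)).comp hpow
  have hAs : 0 < A ^ (-s) := by positivity
  -- Once `(A x)^(-s) ≥ 2(j+1)`, rounding down and dropping the first `j` indices lose at most half
  -- of the sample points.
  filter_upwards [hlarge.eventually_ge_atTop (2 * (j + 1) / A ^ (-s))] with k hk
  set x : ℝ := ρ ^ M k with hx
  have hx0 : 0 < x := pow_pos h0 _
  rw [div_le_iff₀ hAs, mul_comm (x ^ (-s))] at hk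
  have hN : A ^ (-s) * x ^ (-s) / 2 ≤ ((⌊(A * x) ^ (-s)⌋₊ - j : ℕ) : ℝ) := by
    have h2 := Nat.lt_floor_add_one ((A * x) ^ (-s))
    rw [Real.mul_rpow hA.le hx0.le] at *
    have h3 : ((⌊A ^ (-s) * x ^ (-s)⌋₊ : ℕ) : ℝ) ≤
        ((⌊A ^ (-s) * x ^ (-s)⌋₊ - j : ℕ) : ℝ) + j := by
      exact_mod_cast (by lia : ⌊A ^ (-s) * x ^ (-s)⌋₊ ≤ ⌊A ^ (-s) * x ^ (-s)⌋₊ - j + j)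
    linarith
  have h2M : (2 : ℝ) ^ (M k - k) = x ^ (-d) / 2 ^ k := by
    rw [pow_sub₀ _ (by norm_num) (hkM k), ← div_eq_mul_inv]
    congr 1
    rw [hx, ← Real.rpow_natCast ρ, ← Real.rpow_mul h0.le, mul_comm, Real.rpow_mul h0.le,
      Real.rpow_neg h0.le, hd, Real.rpow_natCast]
    norm_num
  have hxk : ρ ^ (-((s - (D - d)) * θ) * k) ≤ x ^ (-(s - (D - d))) := by
    rw [hx, ← Real.rpow_natCast ρ, ← Real.rpow_mul h0.le]
    refine Real.rpow_le_rpow_of_exponent_ge h0 h1.le ?_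
    nlinarith [hM k]
  calc c * A ^ (-s) / 2 * (ρ ^ (-((s - (D - d)) * θ)) / 2) ^ k
      = c * A ^ (-s) / 2 / 2 ^ k * ρ ^ (-((s - (D - d)) * θ) * k) := by
        rw [div_pow, Real.rpow_mul h0.le, Real.rpow_natCast]
        ring
    _ ≤ c * A ^ (-s) / 2 / 2 ^ k * x ^ (-(s - (D - d))) := by gcongr
    _ = x ^ (-d) / 2 ^ k * (c * x ^ D) * (A ^ (-s) * x ^ (-s) / 2) := by
        rw [show -(s - (D - d)) = -d + D + -s by ring, Real.rpow_add hx0, Real.rpow_add hx0]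
        ring
    _ ≤ _ := by
        rw [h2M]
        gcongr

/-- The probability that the sample points with indices in `[j, N)` miss a set. -/
theorem infinitePi_forall_notMem_le {μ : Measure ℝ} [IsProbabilityMeasure μ] {V : Set ℝ}
    (hV : MeasurableSet V) {p : ℝ} (hp : 0 ≤ p) (hpV : ENNReal.ofReal p ≤ μ V) (j N : ℕ) :
    (Measure.infinitePi fun _ : ℕ => μ) {ω | ∀ n ∈ Finset.Ico j N, ω n ∉ V} ≤
      ENNReal.ofReal (Real.exp (-(p * (N - j : ℕ)))) := by
  have : {ω : ℕ → ℝ | ∀ n ∈ Finset.Ico j N, ω n ∉ V} =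
      ((Finset.Ico j N : Finset ℕ) : Set ℕ).pi fun _ => Vᶜ := by
    ext ω
    simp [Set.mem_pi]
  rw [this, Measure.infinitePi_pi _ fun _ _ => hV.compl, Finset.prod_const, Nat.card_Ico,
    prob_compl_eq_one_sub hV, mul_comm, ← mul_neg, Real.exp_nat_mul,
    ENNReal.ofReal_pow (Real.exp_pos _).le]
  gcongr
  calc 1 - μ V ≤ 1 - ENNReal.ofReal p := by gcongr
    _ = ENNReal.ofReal (1 - p) := by rw [ENNReal.ofReal_sub _ hp, ENNReal.ofReal_one]
    _ ≤ _ := ENNReal.ofReal_le_ofReal (by linarith [Real.add_one_le_exp (-p)])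

section RandomCovering

variable {μ : Measure ℝ} [IsProbabilityMeasure μ] {ρ d D s c A θ : ℝ}
  {U : (m : ℕ) → (Fin m → Bool) → Set ℝ}

/-- Almost surely, every long cylinder has an extension of length `M k` that is hit by a sample
point whose radius is still large. -/
theorem ae_forall_exists_hit (h0 : 0 < ρ) (h1 : ρ < 1) (hd : ρ ^ d = 1 / 2) (hs : 0 < s)
    (hc : 0 < c) (hA : 0 < A) (hθ : 1 ≤ θ) (ht : d < (s - (D - d)) * θ) (hd0 : 0 < d)
    {M : ℕ → ℕ} (hM : ∀ k, θ * k ≤ M k)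
    (hUm : ∀ m u, MeasurableSet (U m u))
    (hUd : ∀ m, Pairwise (Function.onFun Disjoint (U m)))
    (hU : ∀ m u, ENNReal.ofReal (c * (ρ ^ m) ^ D) ≤ μ (U m u)) :
    ∀ᵐ ω ∂(Measure.infinitePi fun _ : ℕ => μ), ∀ j : ℕ, ∃ K, ∀ k ≥ K, ∀ w : ℕ → Bool,
      ∃ u : ℕ → Bool, AgreeBelow k w u ∧
        ∃ n ≥ j, n < ⌊(A * ρ ^ M k) ^ (-s)⌋₊ ∧ ω n ∈ U (M k) (fun i => u i) := by
  classical
  have ht0 : 0 < s - (D - d) := by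
    by_contra h
    nlinarith
  have hkM : ∀ k, k ≤ M k := fun k => by
    have : (k : ℝ) ≤ M k := le_trans (le_mul_of_one_le_left (by positivity) hθ) (hM k)
    exact_mod_cast this
  let ext : (k : ℕ) → (Fin k → Bool) → ℕ → Bool := fun k w i => if h : i < k then w ⟨i, h⟩ else false
  let S : (k : ℕ) → (ℕ → Bool) → Finset (Fin (M k) → Bool) := fun k w =>
    Finset.univ.filter fun u : Fin (M k) → Bool => ∀ i : Fin (M k), (i : ℕ) < k → u i = w i
  let V : (k : ℕ) → (ℕ → Bool) → Set ℝ := fun k w => ⋃ u ∈ S k w, U (M k) u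
  let N : ℕ → ℕ := fun k => ⌊(A * ρ ^ M k) ^ (-s)⌋₊
  have hVm : ∀ k w, MeasurableSet (V k w) := fun k w =>
    Finset.measurableSet_biUnion _ fun u _ => hUm _ u
  have hV : ∀ k w, ENNReal.ofReal (2 ^ (M k - k) * (c * (ρ ^ M k) ^ D)) ≤ μ (V k w) := by
    intro k w
    rw [measure_biUnion_finset (fun u _ v _ huv => hUd _ huv) fun u _ => hUm _ u]
    refine le_trans ?_ (Finset.card_nsmul_le_sum _ _ _ fun u _ => hU (M k) u)
    rw [card_extensions (hkM k), nsmul_eq_mul, ENNReal.ofReal_mul (by positivity),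
      ENNReal.ofReal_pow (by norm_num)]
    simp
  rw [ae_all_iff]
  intro j
  -- Only finitely many words matter at level `k`, since `V k w` depends on the first `k`
  -- coordinates of `w`.
  let Bad : ℕ → Set (ℕ → ℝ) := fun k =>
    ⋃ w : Fin k → Bool, {ω | ∀ n ∈ Finset.Ico j (N k), ω n ∉ V k (ext k w)}
  have hBad : ∀ᶠ k in atTop, (Measure.infinitePi fun _ : ℕ => μ) (Bad k) ≤ (2⁻¹ : ℝ≥0∞) ^ k := by
    -- Since `ρ^(-d) = 2`, growth of the expected number of hits in each cylinder is exactly the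
    -- condition `d < (s - (D - d)) θ`.
    have hγ : 1 < ρ ^ (-((s - (D - d)) * θ)) / 2 := by
      rw [lt_div_iff₀ (by norm_num), one_mul]
      have : ρ ^ (-d) = 2 := by
        rw [Real.rpow_neg h0.le, hd]
        norm_num
      rw [← this]
      exact Real.rpow_lt_rpow_of_exponent_gt h0 h1 (by linarith)
    filter_upwards [eventually_two_pow_mul_exp_le (show 0 < c * A ^ (-s) / 2 by positivity) hγ,
      eventually_le_expected_hits h0 h1 hd hs hc hA hθ ht0 hM j] with k hk1 hk2
    calc (Measure.infinitePi fun _ : ℕ => μ) (Bad k)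
        ≤ ∑ w : Fin k → Bool, (Measure.infinitePi fun _ : ℕ => μ)
            {ω | ∀ n ∈ Finset.Ico j (N k), ω n ∉ V k (ext k w)} := measure_iUnion_fintype_le _ _
      _ ≤ ∑ _w : Fin k → Bool, ENNReal.ofReal
            (Real.exp (-(2 ^ (M k - k) * (c * (ρ ^ M k) ^ D) * (N k - j : ℕ)))) :=
          Finset.sum_le_sum fun w _ =>
            infinitePi_forall_notMem_le (hVm k _) (by positivity) (hV k _) j (N k)
      _ = ENNReal.ofReal (2 ^ k *
            Real.exp (-(2 ^ (M k - k) * (c * (ρ ^ M k) ^ D) * (N k - j : ℕ)))) := by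
          rw [ENNReal.ofReal_mul (by positivity), ENNReal.ofReal_pow (by norm_num)]
          simp
      _ ≤ ENNReal.ofReal ((1 / 2) ^ k) := by
          refine ENNReal.ofReal_le_ofReal (le_trans ?_ hk1)
          gcongr
      _ = _ := by
          rw [ENNReal.ofReal_pow (by norm_num), one_div, ENNReal.ofReal_inv_of_pos (by norm_num)]
          simp
  obtain ⟨K, hK⟩ := eventually_atTop.1 hBad
  -- Borel–Cantelli, applied from level `K` on because the bound on `Bad` is only eventual.
  have hsum : ∑' k, (Measure.infinitePi fun _ : ℕ => μ) (Bad (k + K)) ≠ ⊤ := by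
    refine ne_top_of_le_ne_top ?_ (ENNReal.tsum_le_tsum fun k =>
      (hK (k + K) (by lia)).trans (pow_le_pow_right_of_le_one' (a := 2⁻¹) (by simp) (Nat.le_add_right k K)))
    rw [ENNReal.tsum_geometric]
    simp
  filter_upwards [ae_eventually_notMem hsum] with ω hω
  obtain ⟨K', hK'⟩ := eventually_atTop.1 hω
  refine ⟨K' + K, fun k hk w => ?_⟩
  have hgood := hK' (k - K) (by lia)
  rw [Nat.sub_add_cancel (by lia)] at hgood
  simp only [Bad, mem_iUnion, not_exists] at hgood
  have hgood := hgood fun i => w i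
  simp only [mem_ofPred_eq] at hgood
  push Not at hgood
  obtain ⟨n, hn, hnV⟩ := hgood
  simp only [V, mem_iUnion, exists_prop] at hnV
  obtain ⟨u, hu, hnU⟩ := hnV
  rw [Finset.mem_Ico] at hn
  refine ⟨ext (M k) u, fun i hi => ?_, n, hn.1, hn.2, ?_⟩
  · have := (Finset.mem_filter.1 hu).2 ⟨i, hi.trans_le (hkM k)⟩ hi
    simp only [ext, dif_pos hi, dif_pos (hi.trans_le (hkM k))] at this ⊢
    exact this.symm
  · convert hnU using 2
    ext i
    simp [ext]

end RandomCovering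

theorem measurableSet_limsupBalls (α : ℝ) (ω : ℕ → ℝ) : MeasurableSet (limsupBalls α ω) :=
  .iInter fun _ => .iUnion fun _ => .iUnion fun _ => Metric.isClosed_closedBall.measurableSet

/-- Lower bound for the dimension of random limsup sets of balls. The sets `U m u` carry mass
`(ρ ^ m) ^ D` of the law of the centres and are within `ρ ^ m` of the corresponding cylinders of
a tree of dimension `d`. -/
theorem ae_le_dimH_limsupBalls {μ : Measure ℝ} [IsProbabilityMeasure μ] {ρ d D α c A : ℝ}
    {U : (m : ℕ) → (Fin m → Bool) → Set ℝ} {F : (ℕ → Bool) → ℝ} (hF : IsCoding ρ F)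
    (h0 : 0 < ρ) (h1 : ρ < 1) (hd0 : 0 < d) (hd : ρ ^ d = 1 / 2) (hα : 0 < α)
    (hc : 0 < c) (hA : 0 < A) (hUm : ∀ m u, MeasurableSet (U m u))
    (hUd : ∀ m, Pairwise (Function.onFun Disjoint (U m)))
    (hU : ∀ m u, ENNReal.ofReal (c * (ρ ^ m) ^ D) ≤ μ (U m u))
    (hFU : ∀ m (u : ℕ → Bool), ∀ y ∈ U m (fun i => u i), |F u - y| ≤ A * ρ ^ m) :
    ∀ᵐ ω ∂(Measure.infinitePi fun _ : ℕ => μ),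
      ENNReal.ofReal (min d (1 / α - (D - d))) ≤ dimH (limsupBalls α ω) := by
  have key : ∀ t : ℝ, 0 < t → t < min d (1 / α - (D - d)) →
      ∀ᵐ ω ∂(Measure.infinitePi fun _ : ℕ => μ), ENNReal.ofReal t ≤ dimH (limsupBalls α ω) := by
    intro t ht htlt
    -- The room between `t` and the target is used twice. With `θ = d/t'` the hitting condition
    -- reads `t' < 1/α - (D-d)`, and with `a = t/d` the measure condition `aθ < 1` reads `t < t'`.
    obtain ⟨t', htt', ht'⟩ := exists_between htlt
    have ht'0 : 0 < t' := ht.trans htt'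
    have hθ : 1 ≤ d / t' := by
      rw [le_div_iff₀ ht'0, one_mul]
      exact (ht'.trans_le (min_le_left _ _)).le
    have hM : ∀ k : ℕ, d / t' * k ≤ ⌈d / t' * k⌉₊ := fun k => Nat.le_ceil _
    have hkM : ∀ k : ℕ, k ≤ ⌈d / t' * k⌉₊ := fun k => by
      have : (k : ℝ) ≤ ⌈d / t' * k⌉₊ := le_trans (le_mul_of_one_le_left (by positivity) hθ) (hM k)
      exact_mod_cast this
    have hs : (0 : ℝ) < 1 / α := by positivity
    filter_upwards [ae_forall_exists_hit h0 h1 hd hs hc hA hθ (D := D)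
      (by rw [← mul_div_assoc, lt_div_iff₀ ht'0, mul_comm]
          gcongr
          exact ht'.trans_le (min_le_right _ _)) hd0 hM hUm hUd hU] with ω hω
    -- The bound on `n` means `n + 1 ≤ (A ρ^m)^(-1/α)`: the ball with index `n` has radius at least
    -- `A ρ^m` and therefore contains the coded point.
    let Hit : ℕ → ℕ → (ℕ → Bool) → Prop := fun j m u =>
      ∃ n ≥ j, n < ⌊(A * ρ ^ m) ^ (-(1 / α))⌋₊ ∧ ω n ∈ U m (fun i => u i)
    have htd : t / d ≤ 1 := by
      rw [div_le_one₀ hd0]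
      exact (htlt.trans_le (min_le_left _ _)).le
    obtain ⟨κ, hκ, hκle, hκHit⟩ := exists_measure_of_hit (Hit := Hit) (a := t / d)
      (fun j m u v huv => by
        rintro ⟨n, hn, hn1, hn2⟩
        refine ⟨n, hn, hn1, ?_⟩
        rwa [show (fun i : Fin m => v i) = fun i : Fin m => u i from
          funext fun i => (huv i i.2).symm])
      (fun k => (Nat.ceil_lt_add_one (by positivity)).le) hkM (by positivity) htd
      (by rw [div_mul_div_cancel₀ hd0.ne', div_lt_one₀ ht'0]; exact htt') hω
    refine hF.le_dimH h0 h1 κ ht (C := 2) (fun u l => (hκle u l).trans (le_of_eq ?_))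
      (measurableSet_limsupBalls α ω) (hκHit.mono fun u hu => ?_)
    · rw [← hd, ← Real.rpow_mul h0.le, ← Real.rpow_natCast ρ, ← Real.rpow_mul h0.le]
      congr 3
      field_simp
    · refine mem_iInter.2 fun j => ?_
      obtain ⟨m, n, hn, hnN, hnU⟩ := hu j
      refine mem_iUnion.2 ⟨n, mem_iUnion.2 ⟨hn, ?_⟩⟩
      rw [Metric.mem_closedBall, Real.dist_eq]
      refine (hFU m u _ hnU).trans ?_
      have hx : 0 < A * ρ ^ m := by positivity
      have hle : (n : ℝ) + 1 ≤ (A * ρ ^ m) ^ (-(1 / α)) := by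
        refine le_trans ?_ (Nat.floor_le (by positivity))
        exact_mod_cast hnN
      calc A * ρ ^ m = ((A * ρ ^ m) ^ (-(1 / α))) ^ (-α) := by
            rw [← Real.rpow_mul hx.le]
            field_simp
            rw [Real.rpow_one]
        _ ≤ _ := Real.rpow_le_rpow_of_nonpos (by positivity) hle (by linarith)
  -- The null set depends on `t`; rational exponents reduce the limit to countably many null sets.
  have hq : ∀ q : ℚ, ∀ᵐ ω ∂(Measure.infinitePi fun _ : ℕ => μ),
      0 < (q : ℝ) → (q : ℝ) < min d (1 / α - (D - d)) →
        ENNReal.ofReal q ≤ dimH (limsupBalls α ω) := by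
    intro q
    by_cases h : 0 < (q : ℝ) ∧ (q : ℝ) < min d (1 / α - (D - d))
    · filter_upwards [key q h.1 h.2] with ω hω _ _ using hω
    · exact ae_of_all _ fun ω h1 h2 => absurd ⟨h1, h2⟩ h
  filter_upwards [ae_all_iff.2 hq] with ω hω
  refine le_of_forall_lt fun y hy => ?_
  obtain ⟨q, hq0, hyq, hqx⟩ := ENNReal.lt_iff_exists_rat_btwn.1 hy
  have hq0' : 0 < (q : ℝ) := by
    rw [← ENNReal.ofReal_pos]
    exact (zero_le).trans_lt hyq
  exact hyq.trans_le (hω q hq0' ((ENNReal.ofReal_lt_ofReal_iff_of_nonneg hq0'.le).1 hqx))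

/-! ### Position of the middle ninths relative to the Cantor set -/

/-- The infinite word that continues `w` by `false`. -/
def extendFalse {k : ℕ} (w : Fin k → Bool) (i : ℕ) : Bool := if h : i < k then w ⟨i, h⟩ else false

theorem extendFalse_restrict {k : ℕ} (w : Fin k → Bool) : (fun i : Fin k => extendFalse w i) = w := by
  ext i
  simp [extendFalse]

/-- For `ρ = 1/3` the separation constant `2 - 2ρ/(1-ρ)` equals 1, which gives the exact threshold
`3^(-l)`. -/
theorem agree_of_cantorPoint_lt {u v : ℕ → Bool} {l : ℕ}
    (h : |cantorPoint u - cantorPoint v| < (1 / 3) ^ l) : AgreeBelow l u v := by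
  refine agree_of_signSeries_lt (ρ := 1 / 3) (by norm_num) (by norm_num) ?_
  rw [cantorPoint_eq, cantorPoint_eq, add_sub_add_right_eq_sub, ← mul_sub, abs_mul] at h
  norm_num at h ⊢
  linarith

theorem cantorPoint_extendFalse {k : ℕ} (w : Fin k → Bool) :
    cantorPoint (extendFalse w) = cantorLeft w := by
  rw [cantorPoint_split _ k, extendFalse_restrict]
  simp [cantorPoint, extendFalse]

theorem cantorLeft_mem {k : ℕ} (w : Fin k → Bool) : cantorLeft w ∈ cantorSet := by
  rw [← cantorPoint_extendFalse]
  exact cantorPoint_mem _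

theorem le_abs_cantorLeft_sub {k : ℕ} {w w' : Fin k → Bool} (h : w ≠ w') :
    (1 / 3 : ℝ) ^ k ≤ |cantorLeft w - cantorLeft w'| := by
  by_contra! hlt
  rw [← cantorPoint_extendFalse, ← cantorPoint_extendFalse] at hlt
  refine h ?_
  rw [← extendFalse_restrict w, ← extendFalse_restrict w']
  ext i
  rw [agree_of_cantorPoint_lt hlt i i.2]

theorem mem_cantorSet_or {z : ℝ} (hz : z ∈ cantorSet) :
    0 ≤ z ∧ z ≤ 1 ∧ (z ≤ 1 / 3 ∨ 2 / 3 ≤ z) := by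
  refine ⟨(cantorSet_subset_unitInterval hz).1, (cantorSet_subset_unitInterval hz).2, ?_⟩
  rw [cantorSet_eq_union_halves] at hz
  rcases hz with ⟨y, hy, rfl⟩ | ⟨y, hy, rfl⟩
  · left
    have := (cantorSet_subset_unitInterval hy).2
    dsimp only
    linarith
  · right
    have := (cantorSet_subset_unitInterval hy).1
    dsimp only
    linarith

theorem middleNinth_mem {k : ℕ} {w : Fin k → Bool} {y : ℝ} (hy : y ∈ middleNinth w) :
    4 / 9 * (1 / 3 : ℝ) ^ k ≤ y - cantorLeft w ∧ y - cantorLeft w ≤ 5 / 9 * (1 / 3 : ℝ) ^ k := by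
  constructor <;> linarith [hy.1, hy.2]

/-- The middle ninth of an interval of level `k` is far from the Cantor set. -/
theorem le_abs_sub_of_mem_middleNinth {k : ℕ} {w : Fin k → Bool} {y : ℝ} (hy : y ∈ middleNinth w)
    {x : ℝ} (hx : x ∈ cantorSet) : (1 / 3 : ℝ) ^ k / 9 ≤ |x - y| := by
  rw [← range_cantorPoint] at hx
  obtain ⟨u, rfl⟩ := hx
  obtain ⟨h1, h2⟩ := middleNinth_mem hy
  rw [cantorPoint_split u k]
  set z := cantorPoint fun i => u (i + k) with hz
  obtain ⟨hz0, hz1, hz2⟩ := mem_cantorSet_or (cantorPoint_mem fun i => u (i + k))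
  rw [← hz] at hz0 hz1 hz2
  have hp : (0 : ℝ) < (1 / 3) ^ k := by positivity
  have h3 : (1 / 3 : ℝ) ^ k * z ≤ (1 / 3) ^ k := mul_le_of_le_one_right hp.le hz1
  have h4 : 0 ≤ (1 / 3 : ℝ) ^ k * z := by positivity
  -- In the interval of `w` itself, the Cantor set avoids the open middle third, leaving `1/9` on
  -- either side of the middle ninth. In another interval, the left end points are at least `3^(-k)`
  -- apart.
  by_cases hw : (fun i : Fin k => u i) = w
  · rw [hw]
    rcases hz2 with h | h
    · have := mul_le_mul_of_nonneg_left h hp.le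
      rw [abs_sub_comm]
      exact le_trans (by linarith) (le_abs_self _)
    · have := mul_le_mul_of_nonneg_left h hp.le
      exact le_trans (by linarith) (le_abs_self _)
  · have h5 := le_abs_cantorLeft_sub hw
    rcases le_abs.1 h5 with h | h
    · exact le_trans (by linarith) (le_abs_self _)
    · rw [abs_sub_comm]
      exact le_trans (by linarith) (le_abs_self _)

theorem disjoint_middleNinth (k : ℕ) :
    Pairwise (Function.onFun Disjoint (middleNinth : (Fin k → Bool) → Set ℝ)) := by
  intro w w' hne
  rw [Function.onFun, Set.disjoint_left]
  intro y hy hy'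
  have hp : (0 : ℝ) < (1 / 3) ^ k := by positivity
  obtain ⟨h1, h2⟩ := middleNinth_mem hy
  obtain ⟨h3, h4⟩ := middleNinth_mem hy'
  rcases le_abs.1 (le_abs_cantorLeft_sub hne) with h | h <;> linarith

theorem abs_cantorPoint_sub_le {k : ℕ} {u : ℕ → Bool} {y : ℝ}
    (hy : y ∈ middleNinth fun i : Fin k => u i) : |cantorPoint u - y| ≤ (1 / 3) ^ k := by
  obtain ⟨h1, h2⟩ := middleNinth_mem hy
  rw [cantorPoint_split u k]
  obtain ⟨hz0, hz1, -⟩ := mem_cantorSet_or (cantorPoint_mem fun i => u (i + k))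
  have hp : (0 : ℝ) < (1 / 3) ^ k := by positivity
  have h3 := mul_le_of_le_one_right hp.le hz1
  have h4 := mul_nonneg hp.le hz0
  rw [abs_le]
  constructor <;> linarith

theorem abs_cantorLeft_sub_le {k : ℕ} {w : Fin k → Bool} {y : ℝ} (hy : y ∈ middleNinth w) :
    |cantorLeft w - y| ≤ (1 / 3) ^ k := by
  rw [← extendFalse_restrict w] at hy
  simpa [cantorPoint_extendFalse] using abs_cantorPoint_sub_le hy

/-! ### Local dimension from two-sided power bounds -/

section LocalDimension

variable {X : Type*} [PseudoMetricSpace X] [MeasurableSpace X] {μ : Measure X} {x : X}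

theorem le_of_forall_mul_rpow_le {c C s t : ℝ} (hc : 0 < c)
    (h : ∀ r : ℝ, 0 < r → r ≤ 1 → c * r ^ s ≤ C * r ^ t) : t ≤ s := by
  by_contra! hlt
  have hlim : Tendsto (fun r : ℝ => C * r ^ (t - s)) (𝓝[>] 0) (𝓝 0) := by
    have := ((Real.continuousAt_rpow_const 0 (t - s) (Or.inr (by linarith))).tendsto.const_mul
      C).mono_left (nhdsWithin_le_nhds (s := Ioi (0 : ℝ)))
    rwa [Real.zero_rpow (by linarith), mul_zero] at this
  refine hc.not_ge (ge_of_tendsto hlim ?_)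
  filter_upwards [Ioo_mem_nhdsGT (one_pos : (0 : ℝ) < 1)] with r hr
  have h1 := h r hr.1 hr.2.le
  have h2 := Real.rpow_pos_of_pos hr.1 s
  rw [show t = (t - s) + s by ring, Real.rpow_add hr.1, ← mul_assoc] at h1
  exact le_of_mul_le_mul_right h1 h2

theorem localDim_eq [IsProbabilityMeasure μ] {D c C r₀ : ℝ} (hD : 0 ≤ D) (hc : 0 < c)
    (hr₀ : 0 < r₀)
    (hlow : ∀ r : ℝ, 0 < r → r ≤ 1 → ENNReal.ofReal (c * r ^ D) ≤ μ (Metric.ball x r))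
    (hup : ∀ r : ℝ, 0 < r → r ≤ r₀ → μ (Metric.ball x r) ≤ ENNReal.ofReal (C * r ^ D)) :
    lowerLocalDim μ x = (D : EReal) ∧ upperLocalDim μ x = (D : EReal) := by
  -- The definition of the lower local dimension quantifies over all radii; beyond `r₀` the total
  -- mass 1 is dominated by `(r / r₀)^D`, as `D ≥ 0`.
  have hup' : ∀ r : ℝ, 0 < r →
      μ (Metric.ball x r) ≤ ENNReal.ofReal (max C (r₀ ^ (-D)) * r ^ D) := by
    intro r hr
    have hrD := Real.rpow_nonneg hr.le D
    rcases le_or_gt r r₀ with h | h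
    · refine (hup r hr h).trans (ENNReal.ofReal_le_ofReal ?_)
      gcongr
      exact le_max_left _ _
    · refine prob_le_one.trans ?_
      rw [← ENNReal.ofReal_one]
      refine ENNReal.ofReal_le_ofReal ?_
      calc (1 : ℝ) = r₀ ^ (-D) * r₀ ^ D := by rw [← Real.rpow_add hr₀, neg_add_cancel, Real.rpow_zero]
        _ ≤ _ := by
          gcongr
          exact le_max_right _ _
  -- `ENNReal.ofReal` clips negative numbers to 0, so the comparison is undone by positivity of the
  -- left side; the constants on the right have no prescribed sign.
  have hpos : ∀ C' s t r : ℝ, 0 < C' → 0 < r →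
      ENNReal.ofReal (C' * r ^ s) ≤ ENNReal.ofReal t → C' * r ^ s ≤ t := by
    intro C' s t r hC hr h
    have : 0 < C' * r ^ s := by positivity
    by_contra! hlt
    exact absurd h (not_le.2 ((ENNReal.ofReal_lt_ofReal_iff this).2 hlt))
  constructor
  · refine le_antisymm (sSup_le ?_) (le_sSup ⟨D, ⟨_, hup'⟩, rfl⟩)
    rintro _ ⟨s, ⟨C', hC'⟩, rfl⟩
    refine EReal.coe_le_coe_iff.2 (le_of_forall_mul_rpow_le (C := C') hc fun r hr hr1 => ?_)
    exact hpos _ _ _ _ hc hr ((hlow r hr hr1).trans (hC' r hr))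
  · refine le_antisymm (sInf_le ⟨D, ⟨c, hc, hlow⟩, rfl⟩) (le_sInf ?_)
    rintro _ ⟨s, ⟨c', hc', h⟩, rfl⟩
    refine EReal.coe_le_coe_iff.2 (le_of_forall_mul_rpow_le (C := max C (r₀ ^ (-D))) hc' fun r hr hr1 => ?_)
    exact hpos _ _ _ _ hc' hr ((h r hr hr1).trans (hup' r hr))

/-- Small balls are null. Hence every natural exponent is admissible for the lower dimension, with a
constant that serves the large radii, and no exponent is admissible for the upper one. -/
theorem localDim_eq_top [IsProbabilityMeasure μ] (hx : x ∉ μ.support) :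
    lowerLocalDim μ x = ⊤ ∧ upperLocalDim μ x = ⊤ := by
  rw [Metric.nhds_basis_ball.notMem_measureSupport] at hx
  obtain ⟨r₀, hr₀, hzero⟩ := hx
  have hz : ∀ r ≤ r₀, μ (Metric.ball x r) = 0 := fun r hr =>
    measure_mono_null (Metric.ball_subset_ball hr) hzero
  constructor
  · refine eq_top_iff.2 (le_of_forall_lt fun y hy => ?_)
    obtain ⟨n, hn⟩ : ∃ n : ℕ, y < ((n : ℝ) : EReal) := by
      induction y with
      | bot => exact ⟨0, EReal.bot_lt_coe _⟩
      | coe y =>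
        obtain ⟨n, hn⟩ := exists_nat_gt y
        exact ⟨n, EReal.coe_lt_coe_iff.2 hn⟩
      | top => exact absurd hy (lt_irrefl _)
    refine hn.trans_le (le_sSup ⟨n, ⟨(r₀ ^ (n : ℝ))⁻¹, fun r hr => ?_⟩, rfl⟩)
    rcases le_or_gt r r₀ with h | h
    · rw [hz r h]
      exact zero_le
    · refine prob_le_one.trans ?_
      rw [← ENNReal.ofReal_one]
      refine ENNReal.ofReal_le_ofReal ?_
      rw [inv_mul_eq_div, one_le_div (by positivity)]
      gcongr
  · rw [upperLocalDim, sInf_eq_top]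
    rintro _ ⟨s, ⟨c, hc, h⟩, rfl⟩
    have hr : 0 < min r₀ 1 := by positivity
    have := h _ hr (min_le_right _ _)
    rw [hz _ (min_le_left _ _), nonpos_iff_eq_zero, ENNReal.ofReal_eq_zero] at this
    have : 0 < c * (min r₀ 1) ^ s := by positivity
    linarith

end LocalDimension

/-! ### The gap measure and its tails -/

/-- The composition of the affine map of the interval with address `w` with the coding of the
support of the Bernoulli convolution. -/
noncomputable def gapMap (lam : ℝ) (a b : (k : ℕ) → (Fin k → Bool) → ℝ) (k : ℕ) (w : Fin k → Bool)
    (u : ℕ → Bool) : ℝ :=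
  a k w * signSeries lam u + b k w

/-- The standing hypotheses on the parameters of `gapMeasure`. -/
structure IsGapData (lam β : ℝ) (a b : (k : ℕ) → (Fin k → Bool) → ℝ) : Prop where
  lam_pos : 0 < lam
  lam_lt : lam < 1 / 3
  one_lt : 1 < β
  ne_zero : ∀ k w, a k w ≠ 0
  mem_middleNinth : ∀ k w u, gapMap lam a b k w u ∈ middleNinth w

theorem bernoulliConvolution_eq (lam : ℝ) :
    bernoulliConvolution lam = coinMeasure.map (signSeries lam) := rfl

theorem isCoding_signSeries_self {ρ : ℝ} (h0 : 0 < ρ) (h1 : ρ < 1 / 2) :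
    IsCoding ρ (signSeries ρ) := by
  simpa using isCoding_signSeries h0 h1 one_ne_zero 0

theorem support_bernoulliConvolution {lam : ℝ} (h0 : 0 < lam) (h1 : lam < 1 / 2) :
    (bernoulliConvolution lam).support = range (signSeries lam) :=
  (isCoding_signSeries_self h0 h1).support_map (by linarith)

section Tail

variable {β : ℝ}

theorem two_rpow_one_sub_lt_one (hβ : 1 < β) : (2 : ℝ) ^ (1 - β) < 1 :=
  Real.rpow_lt_one_of_one_lt_of_neg (by norm_num) (by linarith)

/-- Level `j` has mass `2^j` and weight `2^(-βj)`, so the tail is geometric with ratio `2^(1-β)`.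
The case `l = 0` is the normalization of `μ`; the general case is the mass carried by levels at
least `l`. -/
theorem hasSum_gap_tail (hβ : 1 < β) (l : ℕ) :
    HasSum (fun j : ℕ => (1 - (2 : ℝ) ^ (1 - β)) * if l ≤ j then 2 ^ (-β * j) * (2 : ℝ) ^ j else 0)
      (2 ^ ((1 - β) * l)) := by
  have hq0 : (0 : ℝ) < 2 ^ (1 - β) := by positivity
  have hq1 := two_rpow_one_sub_lt_one hβ
  have hterm : ∀ j : ℕ, (2 : ℝ) ^ (-β * j) * (2 : ℝ) ^ j = (2 ^ (1 - β)) ^ j := by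
    intro j
    rw [← Real.rpow_natCast 2 j, ← Real.rpow_add (by norm_num), ← Real.rpow_natCast,
      ← Real.rpow_mul (by norm_num)]
    congr 1
    ring
  have hpow : (2 : ℝ) ^ ((1 - β) * l) = (2 ^ (1 - β)) ^ l := by
    rw [Real.rpow_mul (by norm_num), Real.rpow_natCast]
  rw [hpow]
  simp only [hterm]
  generalize (2 : ℝ) ^ (1 - β) = q at *
  have h1 : HasSum (fun j : ℕ => (1 - q) * if l ≤ j + l then q ^ (j + l) else 0) (q ^ l) := by
    have := ((hasSum_geometric_of_lt_one hq0.le hq1).mul_left (q ^ l)).mul_left (1 - q)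
    rw [show (1 - q) * (q ^ l * (1 - q)⁻¹) = q ^ l by
      rw [mul_comm, mul_assoc, inv_mul_cancel₀ (by linarith), mul_one]] at this
    refine this.congr_fun fun j => ?_
    rw [if_pos (Nat.le_add_left l j), pow_add, mul_comm (q ^ j)]
  have h2 := (hasSum_nat_add_iff (f := fun j => (1 - q) * if l ≤ j then q ^ j else 0) l).1 h1
  rwa [Finset.sum_eq_zero, add_zero] at h2
  intro j hj
  rw [if_neg (not_le.2 (Finset.mem_range.1 hj)), mul_zero]

theorem tsum_gap_tail (hβ : 1 < β) (l : ℕ) :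
    ENNReal.ofReal (1 - 2 ^ (1 - β)) * ∑' j : ℕ, ENNReal.ofReal (2 ^ (-β * j)) *
      (if l ≤ j then 2 ^ j else 0) = ENNReal.ofReal (2 ^ ((1 - β) * l)) := by
  have h := hasSum_gap_tail hβ l
  have hq1 := two_rpow_one_sub_lt_one hβ
  rw [← h.tsum_eq, ENNReal.ofReal_tsum_of_nonneg _ h.summable, ← ENNReal.tsum_mul_left]
  · congr 1
    ext j
    rw [ENNReal.ofReal_mul (by linarith)]
    congr 1
    split_ifs
    · rw [ENNReal.ofReal_mul (by positivity), ENNReal.ofReal_pow (by norm_num)]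
      simp
    · simp
  · intro j
    have : (0 : ℝ) ≤ 1 - 2 ^ (1 - β) := by linarith
    split_ifs <;> positivity

end Tail

namespace IsGapData

variable {lam β : ℝ} {a b : (k : ℕ) → (Fin k → Bool) → ℝ}

theorem isCoding (h : IsGapData lam β a b) (k : ℕ) (w : Fin k → Bool) :
    IsCoding lam (gapMap lam a b k w) :=
  isCoding_signSeries h.lam_pos (by linarith [h.lam_lt]) (h.ne_zero k w) (b k w)

theorem lam_lt_one (h : IsGapData lam β a b) : lam < 1 := by linarith [h.lam_lt]

theorem measurable_gapMap (h : IsGapData lam β a b) (k : ℕ) (w : Fin k → Bool) :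
    Measurable (gapMap lam a b k w) :=
  (h.isCoding k w).measurable h.lam_lt_one

theorem levelMeasure_eq (h : IsGapData lam β a b) (k : ℕ) :
    levelMeasure lam a b k = ∑ w : Fin k → Bool, coinMeasure.map (gapMap lam a b k w) := by
  refine Finset.sum_congr rfl fun w _ => ?_
  rw [bernoulliConvolution_eq, Measure.map_map (by fun_prop)
    ((isCoding_signSeries_self h.lam_pos (by linarith [h.lam_lt])).measurable h.lam_lt_one)]
  rfl

theorem levelMeasure_apply (h : IsGapData lam β a b) (k : ℕ) (S : Set ℝ) :
    levelMeasure lam a b k S = ∑ w : Fin k → Bool, coinMeasure.map (gapMap lam a b k w) S := by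
  rw [h.levelMeasure_eq, Measure.finsetSum_apply]

theorem gapMeasure_apply {S : Set ℝ} (hS : MeasurableSet S) :
    gapMeasure lam β a b S = ENNReal.ofReal (1 - 2 ^ (1 - β)) *
      ∑' k : ℕ, ENNReal.ofReal (2 ^ (-β * k)) * levelMeasure lam a b k S := by
  rw [gapMeasure, Measure.smul_apply, Measure.sum_apply _ hS]
  rfl

theorem isProbabilityMeasure_map (h : IsGapData lam β a b) (k : ℕ) (w : Fin k → Bool) :
    IsProbabilityMeasure (coinMeasure.map (gapMap lam a b k w)) :=
  Measure.isProbabilityMeasure_map (h.measurable_gapMap k w).aemeasurable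

theorem isProbabilityMeasure (h : IsGapData lam β a b) :
    IsProbabilityMeasure (gapMeasure lam β a b) := by
  constructor
  rw [gapMeasure_apply MeasurableSet.univ]
  have h1 := tsum_gap_tail h.one_lt 0
  simp only [zero_le, if_true, Nat.cast_zero, mul_zero, Real.rpow_zero, ENNReal.ofReal_one] at h1
  rw [← h1]
  congr 2
  ext k
  rw [h.levelMeasure_apply]
  have := h.isProbabilityMeasure_map
  simp

theorem le_gapMeasure (k : ℕ) (S : Set ℝ) (hS : MeasurableSet S) :
    ENNReal.ofReal (1 - 2 ^ (1 - β)) * (ENNReal.ofReal (2 ^ (-β * k)) * levelMeasure lam a b k S) ≤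
      gapMeasure lam β a b S := by
  rw [gapMeasure_apply hS]
  gcongr
  exact ENNReal.le_tsum (f := fun k : ℕ => ENNReal.ofReal (2 ^ (-β * k)) * levelMeasure lam a b k S) k

theorem map_le_gapMeasure (h : IsGapData lam β a b) (k : ℕ) (w : Fin k → Bool) {S : Set ℝ}
    (hS : MeasurableSet S) :
    ENNReal.ofReal ((1 - 2 ^ (1 - β)) * 2 ^ (-β * k)) * coinMeasure.map (gapMap lam a b k w) S ≤
      gapMeasure lam β a b S := by
  refine le_trans ?_ (le_gapMeasure k S hS)
  rw [ENNReal.ofReal_mul (by linarith [two_rpow_one_sub_lt_one h.one_lt]), mul_assoc,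
    h.levelMeasure_apply]
  gcongr
  exact Finset.single_le_sum (f := fun w => coinMeasure.map (gapMap lam a b k w) S)
    (fun _ _ => zero_le) (Finset.mem_univ w)

theorem map_eq_zero (h : IsGapData lam β a b) {k : ℕ} {w : Fin k → Bool} {S : Set ℝ}
    (hS : MeasurableSet S) (hd : Disjoint (range (gapMap lam a b k w)) S) :
    coinMeasure.map (gapMap lam a b k w) S = 0 := by
  rw [Measure.map_apply (h.measurable_gapMap k w) hS]
  rw [show gapMap lam a b k w ⁻¹' S = ∅ from ?_, measure_empty]
  rw [eq_empty_iff_forall_notMem]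
  exact fun u hu => Set.disjoint_left.1 hd (mem_range_self u) hu

theorem range_subset (h : IsGapData lam β a b) (k : ℕ) (w : Fin k → Bool) :
    range (gapMap lam a b k w) ⊆ middleNinth w := by
  rintro _ ⟨u, rfl⟩
  exact h.mem_middleNinth k w u

theorem isClosed_range (h : IsGapData lam β a b) (k : ℕ) (w : Fin k → Bool) :
    IsClosed (range (gapMap lam a b k w)) :=
  (isCompact_range ((h.isCoding k w).continuous h.lam_lt_one)).isClosed

theorem _root_.measurableSet_middleNinth {k : ℕ} (w : Fin k → Bool) :
    MeasurableSet (middleNinth w) := isClosed_Icc.measurableSet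

theorem le_gapMeasure_middleNinth (h : IsGapData lam β a b) (k : ℕ) (w : Fin k → Bool) :
    ENNReal.ofReal ((1 - 2 ^ (1 - β)) * 2 ^ (-β * k)) ≤ gapMeasure lam β a b (middleNinth w) := by
  refine le_trans (le_of_eq ?_) (h.map_le_gapMeasure k w (measurableSet_middleNinth w))
  rw [Measure.map_apply (h.measurable_gapMap k w) (measurableSet_middleNinth w),
    show gapMap lam a b k w ⁻¹' middleNinth w = univ from
      eq_univ_of_forall fun u => h.mem_middleNinth k w u, measure_univ, mul_one]

/-- The number of intervals of level `k` whose middle ninth meets `S` bounds `μ_k S`. -/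
theorem levelMeasure_le (h : IsGapData lam β a b) {S : Set ℝ} (hS : MeasurableSet S) {k : ℕ}
    {T : Finset (Fin k → Bool)} (hT : ∀ w, (middleNinth w ∩ S).Nonempty → w ∈ T) :
    levelMeasure lam a b k S ≤ T.card := by
  classical
  have := h.isProbabilityMeasure_map
  rw [h.levelMeasure_apply]
  calc ∑ w : Fin k → Bool, coinMeasure.map (gapMap lam a b k w) S
      = ∑ w ∈ T, coinMeasure.map (gapMap lam a b k w) S := by
        refine (Finset.sum_subset (Finset.subset_univ _) fun w _ hw => ?_).symm
        refine h.map_eq_zero hS (Set.disjoint_left.2 fun x hx hxS => hw (hT w ⟨x, ?_, hxS⟩))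
        exact h.range_subset k w hx
    _ ≤ ∑ w ∈ T, 1 := Finset.sum_le_sum fun w _ => prob_le_one
    _ = T.card := by simp

/-- A set that misses the levels below `l` and gets at most the fraction `C` of every later level
gets at most that fraction of the tail. -/
theorem gapMeasure_le (h : IsGapData lam β a b) {S : Set ℝ} (hS : MeasurableSet S) {l : ℕ}
    {C : ℝ≥0∞} (hC : ∀ j, levelMeasure lam a b j S ≤ C * if l ≤ j then 2 ^ j else 0) :
    gapMeasure lam β a b S ≤ C * ENNReal.ofReal (2 ^ ((1 - β) * l)) := by
  rw [gapMeasure_apply hS, ← tsum_gap_tail h.one_lt l, ← mul_assoc, mul_comm C, mul_assoc,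
    ← ENNReal.tsum_mul_left (a := C)]
  refine mul_le_mul_right (ENNReal.tsum_le_tsum fun j => ?_) _
  rw [mul_left_comm]
  exact mul_le_mul_right (hC j) _

theorem support_levelMeasure (h : IsGapData lam β a b) (k : ℕ) :
    (levelMeasure lam a b k).support = ⋃ w : Fin k → Bool, range (gapMap lam a b k w) := by
  refine Subset.antisymm (Measure.support_subset_of_isClosed
    (isClosed_iUnion_of_finite fun w => h.isClosed_range k w) ?_) (iUnion_subset fun w => ?_)
  · rw [mem_ae_iff, h.levelMeasure_apply]
    refine Finset.sum_eq_zero fun w _ => h.map_eq_zero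
      (isClosed_iUnion_of_finite fun w => h.isClosed_range k w).measurableSet.compl ?_
    exact disjoint_compl_right.mono_left (subset_iUnion (fun w => range (gapMap lam a b k w)) w)
  · rw [← (h.isCoding k w).support_map h.lam_lt_one, h.levelMeasure_eq]
    refine Measure.support_mono (Measure.le_iff.2 fun S _ => ?_)
    rw [Measure.finsetSum_apply]
    exact Finset.single_le_sum (f := fun w => coinMeasure.map (gapMap lam a b k w) S)
      (fun _ _ => zero_le) (Finset.mem_univ w)

end IsGapData

/-! ### Mass near the Cantor set, local dimensions and support -/

theorem rpow_log_two_div {ρ : ℝ} (h0 : 0 < ρ) (h1 : ρ < 1) :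
    ρ ^ (Real.log 2 / (-Real.log ρ)) = 1 / 2 := by
  have := Real.log_neg h0 h1
  rw [Real.rpow_def_of_pos h0, div_neg, mul_neg, mul_div_cancel₀ _ this.ne, Real.exp_neg,
    Real.exp_log (by norm_num), one_div]

theorem third_rpow_mul (t : ℝ) : (1 / 3 : ℝ) ^ (t * Real.log 2 / Real.log 3) = 2 ^ (-t) := by
  have h3 : Real.log 3 ≠ 0 := (Real.log_pos (by norm_num)).ne'
  rw [Real.rpow_def_of_pos (by norm_num), Real.rpow_def_of_pos (by norm_num), one_div, Real.log_inv]
  congr 1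
  field_simp

theorem third_pow_rpow_mul (t : ℝ) (l : ℕ) :
    ((1 / 3 : ℝ) ^ l) ^ (t * Real.log 2 / Real.log 3) = 2 ^ (-t * l) := by
  rw [← Real.rpow_natCast (1 / 3), ← Real.rpow_mul (by norm_num), mul_comm,
    Real.rpow_mul (by norm_num), third_rpow_mul, ← Real.rpow_mul (by norm_num)]

namespace IsGapData

variable {lam β : ℝ} {a b : (k : ℕ) → (Fin k → Bool) → ℝ}

/-- Intervals of level `j` are too large to have their middle ninth near the Cantor set. -/
theorem levelMeasure_eq_zero (h : IsGapData lam β a b) {S : Set ℝ} (hS : MeasurableSet S) {j : ℕ}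
    {r : ℝ} (hr : ∀ y ∈ S, ∃ x ∈ cantorSet, |x - y| ≤ r) (hj : 9 * r < (1 / 3) ^ j) :
    levelMeasure lam a b j S = 0 := by
  refine nonpos_iff_eq_zero.1 ((h.levelMeasure_le hS (T := ∅) ?_).trans (by simp))
  rintro w ⟨y, hy, hyS⟩
  obtain ⟨x, hx, hxy⟩ := hr y hyS
  have := le_abs_sub_of_mem_middleNinth hy hx
  linarith

/-- A level with `9r < 3^(-j)` stays away from the ball, which includes all `j < l`. Otherwise
`3^(-j) ≤ 9r`, and an interval whose middle ninth meets the ball has its left end within `10r <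
3^(-l)` of the centre. Its word then starts with the first `l` digits of `u`, which leaves `2^(j-l)`
words. -/
theorem levelMeasure_ball_le (h : IsGapData lam β a b) (u : ℕ → Bool) {r : ℝ} {l : ℕ}
    (hr : 20 * r ≤ (1 / 3) ^ l) (j : ℕ) :
    levelMeasure lam a b j (Metric.ball (cantorPoint u) r) ≤
      2⁻¹ ^ l * if l ≤ j then 2 ^ j else 0 := by
  classical
  have hball : MeasurableSet (Metric.ball (cantorPoint u) r) := Metric.isOpen_ball.measurableSet
  have hp : (0 : ℝ) < (1 / 3) ^ l := by positivity
  split_ifs with hlj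
  · rcases lt_or_ge (9 * r) ((1 / 3) ^ j) with hlt | hge
    · rw [h.levelMeasure_eq_zero hball (r := r) (fun y hy => ⟨_, cantorPoint_mem u, ?_⟩) hlt]
      · exact zero_le
      · rw [Metric.mem_ball, dist_comm] at hy
        exact hy.le
    · refine (h.levelMeasure_le hball
        (T := Finset.univ.filter fun w : Fin j → Bool => ∀ i : Fin j, (i : ℕ) < l → w i = u i)
        ?_).trans ?_
      · rintro w ⟨y, hy, hyS⟩
        rw [Finset.mem_filter]
        refine ⟨Finset.mem_univ _, fun i hi => ?_⟩
        rw [Metric.mem_ball, Real.dist_eq] at hyS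
        have h1 := abs_cantorLeft_sub_le hy
        have h2 : |cantorPoint (extendFalse w) - cantorPoint u| < (1 / 3) ^ l := by
          rw [cantorPoint_extendFalse]
          have := abs_sub_le (cantorLeft w) y (cantorPoint u)
          linarith [abs_nonneg (y - cantorPoint u)]
        rw [← agree_of_cantorPoint_lt h2 i hi]
        simp [extendFalse]
      · rw [card_extensions hlj]
        push_cast
        rw [← ENNReal.inv_pow]
        refine le_of_eq ?_
        nth_rewrite 2 [← Nat.add_sub_cancel' hlj]
        rw [pow_add, ← mul_assoc, ENNReal.inv_mul_cancel (pow_ne_zero _ (by norm_num)) (by simp),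
          one_mul]
  · rw [h.levelMeasure_eq_zero hball (r := r) (fun y hy => ⟨_, cantorPoint_mem u, ?_⟩)]
    · exact zero_le
    · have := pow_le_pow_of_le_one (by norm_num : (0 : ℝ) ≤ 1 / 3) (by norm_num) (not_le.1 hlj).le
      rcases le_or_gt r 0 with h0 | h0
      · have : (0 : ℝ) < (1 / 3) ^ j := by positivity
        linarith
      · linarith
    · rw [Metric.mem_ball, dist_comm] at hy
      exact hy.le

/-- The local dimension of `gapMeasure` at points of the Cantor set. -/
theorem localDim_of_mem_cantorSet (h : IsGapData lam β a b) {x : ℝ} (hx : x ∈ cantorSet) :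
    lowerLocalDim (gapMeasure lam β a b) x = ((β * Real.log 2 / Real.log 3 : ℝ) : EReal) ∧
      upperLocalDim (gapMeasure lam β a b) x = ((β * Real.log 2 / Real.log 3 : ℝ) : EReal) := by
  have := h.isProbabilityMeasure
  have hlog3 : 0 < Real.log 3 := Real.log_pos (by norm_num)
  have hlog2 : 0 < Real.log 2 := Real.log_pos (by norm_num)
  have hβ := h.one_lt
  have hq := two_rpow_one_sub_lt_one h.one_lt
  set s := β * Real.log 2 / Real.log 3 with hs
  have hs0 : 0 < s := by positivity
  rw [← range_cantorPoint] at hx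
  obtain ⟨u, rfl⟩ := hx
  -- For the lower bound, `3^(-(k+1)) < r/2 ≤ 3^(-k)`: a single middle ninth of level `k + 1` lies
  -- in the ball, and `3^(-(k+1)) ≥ r/6`. For the upper bound, `3^(-(l+1)) < 20r ≤ 3^(-l)`, so
  -- `3^(-l) < 60r`.
  refine localDim_eq (c := (1 - 2 ^ (1 - β)) * (1 / 6) ^ s) (C := 60 ^ s) (r₀ := 1 / 20) hs0.le
    (mul_pos (by linarith) (by positivity)) (by norm_num) (fun r hr hr1 => ?_) fun r hr hr1 => ?_
  · obtain ⟨k, hk1, hk2⟩ := exists_nat_pow_near_of_lt_one (x := r / 2) (y := 1 / 3) (by positivity)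
      (by linarith) (by norm_num) (by norm_num)
    calc ENNReal.ofReal ((1 - 2 ^ (1 - β)) * (1 / 6) ^ s * r ^ s)
        ≤ ENNReal.ofReal ((1 - 2 ^ (1 - β)) * 2 ^ (-β * (k + 1 : ℕ))) := by
          refine ENNReal.ofReal_le_ofReal ?_
          rw [mul_assoc, ← Real.mul_rpow (by norm_num) hr.le, ← third_pow_rpow_mul, ← hs, pow_succ]
          refine mul_le_mul_of_nonneg_left ?_ (by linarith)
          exact Real.rpow_le_rpow (by positivity) (by linarith) hs0.le
      _ ≤ gapMeasure lam β a b (middleNinth fun i : Fin (k + 1) => u i) :=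
          h.le_gapMeasure_middleNinth _ _
      _ ≤ _ := by
          refine measure_mono fun y hy => ?_
          rw [Metric.mem_ball, dist_comm, Real.dist_eq]
          exact (abs_cantorPoint_sub_le hy).trans_lt (by linarith)
  · obtain ⟨l, hl1, hl2⟩ := exists_nat_pow_near_of_lt_one (x := 20 * r) (y := 1 / 3) (by positivity)
      (by linarith) (by norm_num) (by norm_num)
    refine (h.gapMeasure_le Metric.isOpen_ball.measurableSet
      (h.levelMeasure_ball_le u hl2)).trans ?_
    rw [show (2⁻¹ : ℝ≥0∞) ^ l = ENNReal.ofReal ((2 : ℝ) ^ (-(l : ℝ))) by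
      rw [Real.rpow_neg (by norm_num), Real.rpow_natCast,
        ENNReal.ofReal_inv_of_pos (by positivity), ENNReal.ofReal_pow (by norm_num),
        ENNReal.inv_pow]
      simp, ← ENNReal.ofReal_mul (by positivity), ← Real.rpow_add (by norm_num)]
    refine ENNReal.ofReal_le_ofReal ?_
    rw [show -(l : ℝ) + (1 - β) * l = -β * l by ring, ← third_pow_rpow_mul, ← hs,
      ← Real.mul_rpow (by norm_num) hr.le]
    rw [pow_succ] at hl1
    exact Real.rpow_le_rpow (by positivity) (by linarith) hs0.le

/-- The mass of neighbourhoods of the Cantor set. -/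
theorem gapMeasure_cthickening_le (h : IsGapData lam β a b) {r : ℝ} (hr : 0 < r) :
    gapMeasure lam β a b (Metric.cthickening r cantorSet) ≤
      ENNReal.ofReal ((27 * r) ^ ((β - 1) * Real.log 2 / Real.log 3)) := by
  have := h.isProbabilityMeasure
  have hlog3 : 0 < Real.log 3 := Real.log_pos (by norm_num)
  have hlog2 : 0 < Real.log 2 := Real.log_pos (by norm_num)
  have hβ : 0 < β - 1 := by linarith [h.one_lt]
  have hS : MeasurableSet (Metric.cthickening r cantorSet) := Metric.isClosed_cthickening.measurableSet
  have hnear : ∀ y ∈ Metric.cthickening r cantorSet, ∃ x ∈ cantorSet, |x - y| ≤ r := by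
    intro y hy
    rw [isCompact_cantorSet.cthickening_eq_biUnion_closedBall hr.le] at hy
    obtain ⟨x, hx, hxy⟩ := mem_iUnion₂.1 hy
    rw [Metric.mem_closedBall, dist_comm] at hxy
    exact ⟨x, hx, hxy⟩
  rcases le_or_gt (9 * r) 1 with h1 | h1
  -- Levels below `l` do not reach the neighbourhood, and later ones are counted in full. The
  -- constant 27 comes from `3^(-(l+1)) < 9r`.
  · obtain ⟨l, hl1, hl2⟩ := exists_nat_pow_near_of_lt_one (x := 9 * r) (y := 1 / 3) (by positivity)
      h1 (by norm_num) (by norm_num)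
    refine (h.gapMeasure_le hS (C := 1) (l := l) fun j => ?_).trans ?_
    · rw [one_mul]
      split_ifs with hlj
      · refine (h.levelMeasure_le hS (T := Finset.univ) fun w _ => Finset.mem_univ w).trans ?_
        simp
      · rw [h.levelMeasure_eq_zero hS hnear]
        have h2 := pow_le_pow_of_le_one (by norm_num : (0 : ℝ) ≤ 1 / 3) (by norm_num)
          (Nat.succ_le_of_lt (not_le.1 hlj))
        rw [Nat.succ_eq_add_one, pow_succ] at h2
        have : (0 : ℝ) < (1 / 3) ^ j := by positivity
        linarith
    · rw [one_mul]
      refine ENNReal.ofReal_le_ofReal ?_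
      rw [show (1 - β) * l = -(β - 1) * l by ring, ← third_pow_rpow_mul]
      rw [pow_succ] at hl1
      exact Real.rpow_le_rpow (by positivity) (by linarith) (by positivity)
  · refine prob_le_one.trans ?_
    rw [← ENNReal.ofReal_one]
    exact ENNReal.ofReal_le_ofReal (Real.one_le_rpow (by linarith) (by positivity))

/-- Only finitely many levels have mass near a point outside the Cantor set. -/
theorem exists_gapMeasure_ball_le (h : IsGapData lam β a b) {x : ℝ} (hx : x ∉ cantorSet) :
    ∃ r₀ : ℝ, 0 < r₀ ∧ ∃ J : ℕ, ∀ r ≤ r₀, gapMeasure lam β a b (Metric.ball x r) ≤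
      ∑ j ∈ Finset.range J, ∑ w : Fin j → Bool,
        coinMeasure.map (gapMap lam a b j w) (Metric.ball x r) := by
  have hβ := h.one_lt
  obtain ⟨δ, hδ, hδx⟩ := Metric.isOpen_iff.1 isClosed_cantorSet.isOpen_compl x hx
  -- An interval of level at least `J` whose middle ninth met the ball would have its left end, a
  -- point of the Cantor set, within `δ` of `x`.
  obtain ⟨J, hJ⟩ := exists_pow_lt_of_lt_one (half_pos hδ) (by norm_num : (1 / 3 : ℝ) < 1)
  refine ⟨δ / 2, half_pos hδ, J, fun r hr => ?_⟩
  have hball : MeasurableSet (Metric.ball x r) := Metric.isOpen_ball.measurableSet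
  have hzero : ∀ j ∉ Finset.range J, levelMeasure lam a b j (Metric.ball x r) = 0 := by
    intro j hj
    refine nonpos_iff_eq_zero.1 ((h.levelMeasure_le hball (T := ∅) ?_).trans (by simp))
    rintro w ⟨y, hy, hyr⟩
    refine absurd (cantorLeft_mem w) (hδx ?_)
    have h1 := abs_cantorLeft_sub_le hy
    have h2 := pow_le_pow_of_le_one (by norm_num : (0 : ℝ) ≤ 1 / 3) (by norm_num)
      (not_lt.1 (mt Finset.mem_range.2 hj))
    rw [Metric.mem_ball] at hyr ⊢
    rw [← Real.dist_eq] at h1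
    linarith [dist_triangle (cantorLeft w) y x]
  rw [gapMeasure_apply hball, tsum_eq_sum (s := Finset.range J) fun j hj => by rw [hzero j hj, mul_zero]]
  calc ENNReal.ofReal (1 - 2 ^ (1 - β)) * ∑ j ∈ Finset.range J,
        ENNReal.ofReal (2 ^ (-β * j)) * levelMeasure lam a b j (Metric.ball x r)
      ≤ 1 * ∑ j ∈ Finset.range J, 1 * levelMeasure lam a b j (Metric.ball x r) := by
        gcongr with j
        · rw [← ENNReal.ofReal_one]
          refine ENNReal.ofReal_le_ofReal ?_
          have : (0 : ℝ) < 2 ^ (1 - β) := by positivity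
          linarith
        · rw [← ENNReal.ofReal_one]
          refine ENNReal.ofReal_le_ofReal (Real.rpow_le_one_of_one_le_of_nonpos (by norm_num) ?_)
          have : (0 : ℝ) ≤ j := by positivity
          nlinarith
    _ = _ := by
        rw [one_mul]
        refine Finset.sum_congr rfl fun j _ => ?_
        rw [one_mul, h.levelMeasure_apply]

theorem range_disjoint_cantorSet (h : IsGapData lam β a b) {k : ℕ} {w : Fin k → Bool} {x : ℝ}
    (hx : x ∈ range (gapMap lam a b k w)) : x ∉ cantorSet := by
  intro hC
  have := le_abs_sub_of_mem_middleNinth (h.range_subset k w hx) hC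
  rw [sub_self, abs_zero] at this
  have : (0 : ℝ) < (1 / 3) ^ k := by positivity
  linarith

/-- The local dimension of `gapMeasure` at points of the images of the Bernoulli convolution. -/
theorem localDim_of_mem_range (h : IsGapData lam β a b) {k : ℕ} {w : Fin k → Bool} {x : ℝ}
    (hx : x ∈ range (gapMap lam a b k w)) :
    lowerLocalDim (gapMeasure lam β a b) x = ((Real.log 2 / (-Real.log lam) : ℝ) : EReal) ∧
      upperLocalDim (gapMeasure lam β a b) x = ((Real.log 2 / (-Real.log lam) : ℝ) : EReal) := by
  have := h.isProbabilityMeasure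
  have hlog2 : 0 < Real.log 2 := Real.log_pos (by norm_num)
  have hlog : 0 < -Real.log lam := by linarith [Real.log_neg h.lam_pos h.lam_lt_one]
  have hd := rpow_log_two_div h.lam_pos h.lam_lt_one
  set s := Real.log 2 / (-Real.log lam) with hs
  have hs0 : 0 < s := by positivity
  have hq := two_rpow_one_sub_lt_one h.one_lt
  obtain ⟨r₀, hr₀, J, hJ⟩ := h.exists_gapMeasure_ball_le (h.range_disjoint_cantorSet hx)
  obtain ⟨u, rfl⟩ := hx
  obtain ⟨c, hc, hlow⟩ := (h.isCoding k w).le_coinMeasure_map_ball h.lam_pos h.lam_lt_one hs0 hd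
  choose C hC hup using fun (j : ℕ) (w : Fin j → Bool) =>
    (h.isCoding j w).coinMeasure_map_le h.lam_pos h.lam_lt_one hs0 hd
  have hm : 0 < (1 - (2 : ℝ) ^ (1 - β)) * 2 ^ (-β * k) := mul_pos (by linarith) (by positivity)
  -- The copy containing the point alone gives the lower bound. The upper bound sums the Frostman
  -- constants of the finitely many copies of level below `J`, where `2^s` comes from the diameter
  -- `2r` of a ball.
  refine localDim_eq (c := (1 - 2 ^ (1 - β)) * 2 ^ (-β * k) * c)
    (C := (∑ j ∈ Finset.range J, ∑ w : Fin j → Bool, C j w) * 2 ^ s) hs0.le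
    (mul_pos hm hc) hr₀ (fun r hr hr1 => ?_) fun r hr hr1 => (hJ r hr1).trans ?_
  · refine le_trans ?_ (h.map_le_gapMeasure k w Metric.isOpen_ball.measurableSet)
    rw [mul_assoc, ENNReal.ofReal_mul hm.le]
    gcongr
    exact hlow u r hr hr1
  · calc ∑ j ∈ Finset.range J, ∑ w : Fin j → Bool,
          coinMeasure.map (gapMap lam a b j w) (Metric.ball (gapMap lam a b k _ u) r)
        ≤ ∑ j ∈ Finset.range J, ∑ w : Fin j → Bool,
            ENNReal.ofReal (C j w) * ENNReal.ofReal ((2 * r) ^ s) := by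
          refine Finset.sum_le_sum fun j _ => Finset.sum_le_sum fun v _ => (hup j v _).trans ?_
          rw [← ENNReal.ofReal_rpow_of_nonneg (by positivity) hs0.le]
          gcongr
          rw [Real.ball_eq_Ioo, Real.ediam_Ioo]
          exact ENNReal.ofReal_le_ofReal (by linarith)
      _ = _ := by
          simp only [← Finset.sum_mul]
          rw [mul_assoc, ← Real.mul_rpow (by norm_num) hr.le, ENNReal.ofReal_mul
            (Finset.sum_nonneg fun j _ => Finset.sum_nonneg fun w _ => (hC j w).le),
            ENNReal.ofReal_sum_of_nonneg fun j _ => Finset.sum_nonneg fun w _ => (hC j w).le]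
          congr 1
          refine Finset.sum_congr rfl fun j _ => ?_
          rw [ENNReal.ofReal_sum_of_nonneg fun w _ => (hC j w).le]

/-- Away from the Cantor set the copies are locally finite in number, so no further points arise.
Conversely, the local dimension is finite at all points on the right, whereas it is `⊤` off the
support. -/
theorem support_gapMeasure (h : IsGapData lam β a b) :
    (gapMeasure lam β a b).support = cantorSet ∪ ⋃ k : ℕ, (levelMeasure lam a b k).support := by
  have := h.isProbabilityMeasure
  ext x
  constructor
  · intro hx
    by_contra hne
    rw [mem_union, not_or] at hne
    obtain ⟨r₀, hr₀, J, hJ⟩ := h.exists_gapMeasure_ball_le hne.1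
    have hopen : IsOpen (⋃ j ∈ Finset.range J, (levelMeasure lam a b j).support)ᶜ :=
      (Set.Finite.isClosed_biUnion (Finset.range J).finite_toSet
        fun j _ => Measure.isClosed_support).isOpen_compl
    obtain ⟨ε, hε, hεx⟩ := Metric.isOpen_iff.1 hopen x (by
      intro hmem
      obtain ⟨j, _, hj⟩ := mem_iUnion₂.1 hmem
      exact hne.2 (mem_iUnion.2 ⟨j, hj⟩))
    have hball : MeasurableSet (Metric.ball x (min r₀ ε)) := Metric.isOpen_ball.measurableSet
    refine (((Metric.nhds_basis_ball (x := x)).mem_measureSupport.1 hx (min r₀ ε)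
      (by positivity)).trans_le (hJ _ (min_le_left _ _))).ne' ?_
    refine Finset.sum_eq_zero fun j hj => Finset.sum_eq_zero fun w _ => h.map_eq_zero hball ?_
    refine Set.disjoint_left.2 fun y hy hyb => ?_
    refine hεx (Metric.ball_subset_ball (min_le_right _ _) hyb) (mem_iUnion₂.2 ⟨j, hj, ?_⟩)
    rw [h.support_levelMeasure]
    exact mem_iUnion.2 ⟨w, hy⟩
  · intro hx
    by_contra hne
    have htop := (localDim_eq_top hne).1
    rcases hx with hx | hx
    · rw [(h.localDim_of_mem_cantorSet hx).1] at htop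
      exact EReal.coe_ne_top _ htop
    · obtain ⟨k, hk⟩ := mem_iUnion.1 hx
      rw [h.support_levelMeasure] at hk
      obtain ⟨w, hw⟩ := mem_iUnion.1 hk
      rw [(h.localDim_of_mem_range hw).1] at htop
      exact EReal.coe_ne_top _ htop

end IsGapData

/-! ### Packing dimension of countable unions -/

theorem packingDim_iUnion_le {X ι : Type*} [PseudoMetricSpace X] [Countable ι] [Nonempty ι]
    {A : ι → Set X} {t : ℝ} (hA : ∀ i, upperBoxDim (A i) ≤ (t : EReal)) :
    packingDim (⋃ i, A i) ≤ ENNReal.ofReal t := by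
  obtain ⟨f, hf⟩ := exists_surjective_nat ι
  refine sInf_le ⟨A ∘ f, fun n => (hA _).trans ?_, ?_⟩
  · rw [EReal.coe_ennreal_ofReal]
    exact EReal.coe_le_coe_iff.2 (le_max_left _ _)
  · exact iUnion_subset fun i => by
      obtain ⟨n, rfl⟩ := hf i
      exact subset_iUnion (A ∘ f) n

theorem upperBoxDim_empty_le {X : Type*} [PseudoMetricSpace X] {t : ℝ} :
    upperBoxDim (∅ : Set X) ≤ (t : EReal) := by
  refine limsup_le_of_le ?_ ?_
  · isBoundedDefault
  · filter_upwards [Ioo_mem_nhdsGT one_pos] with r hr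
    have hlog : 0 < -Real.log r := by
      linarith [Real.log_neg (NNReal.coe_pos.2 hr.1) (by exact_mod_cast hr.2 : (r : ℝ) < 1)]
    rw [Metric.externalCoveringNumber_empty, ENat.toENNReal_zero, ENNReal.log_zero,
      EReal.bot_div_of_pos_ne_top (by exact_mod_cast hlog) (EReal.coe_ne_top _)]
    exact bot_le

/-! ### The increasing 1-Lipschitz hull of a two-step function -/

section Hull

variable {s₀ s₁ d₁ : ℝ}

/-- A competitor `h` satisfies `h s ≥ g t - max (t - s) 0` for every `t`, by monotonicity for `t ≤
s` and the Lipschitz bound for `t ≥ s`. The two jumps `t = s₀` and `t = s₁` already give the claimed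
value, and that value is itself attained by a competitor. -/
theorem increasingLipschitzHull_step (h0 : 0 < s₀) (h1 : s₀ < d₁) (h2 : d₁ < s₁) {g : ℝ → ℝ}
    (hg : ∀ z, g z = if z < s₀ then 0 else if z < s₁ then s₀ else d₁) {s : ℝ} (hs : 0 ≤ s) :
    increasingLipschitzHull g s = max (min s s₀) (min s s₁ - (s₁ - d₁)) := by
  -- The outer `max 0` keeps the competitor above `g` on the negative axis and changes nothing at `s
  -- ≥ 0`. The constant `d₁` shows that the set of competitors is nonempty.
  refine le_antisymm (csInf_le ⟨g s, ?_⟩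
    ⟨fun x => max 0 (max (min x s₀) (min x s₁ + -(s₁ - d₁))), ?_, ?_, fun z => ?_, ?_⟩)
    (le_csInf ⟨_, fun _ => d₁, monotone_const, LipschitzWith.const' d₁, fun z => ?_, rfl⟩ ?_)
  · rintro _ ⟨h, -, -, hle, rfl⟩
    exact hle s
  · intro x y hxy
    dsimp only
    gcongr
  · have := ((LipschitzWith.id.min_const s₀).max
      ((LipschitzWith.id.min_const s₁).add (LipschitzWith.const (-(s₁ - d₁))))).const_max 0
    simpa using this
  · rw [hg]
    split_ifs with hz hz'
    · exact le_max_left _ _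
    · push Not at hz
      refine le_trans ?_ (le_max_right _ _)
      refine le_trans ?_ (le_max_left _ _)
      rw [min_eq_right hz]
    · push Not at hz'
      refine le_trans ?_ (le_max_right _ _)
      refine le_trans ?_ (le_max_right _ _)
      rw [min_eq_right hz']
      linarith
  · have : 0 ≤ max (min s s₀) (min s s₁ + -(s₁ - d₁)) := le_max_of_le_left (le_min hs h0.le)
    dsimp only
    rw [max_eq_right this, sub_eq_add_neg]
  · rw [hg]
    split_ifs <;> linarith
  · rintro _ ⟨h, hmono, hlip, hle, rfl⟩
    have key : ∀ t, g t - max (t - s) 0 ≤ h s := by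
      intro t
      rcases le_total t s with hts | hts
      · linarith [hle t, hmono hts, le_max_right (t - s) 0]
      · have h1 := hlip.dist_le_mul t s
        rw [Real.dist_eq, Real.dist_eq, NNReal.coe_one, one_mul, abs_of_nonneg (sub_nonneg.2 hts)]
          at h1
        linarith [hle t, le_abs_self (h t - h s), le_max_left (t - s) 0]
    have k0 := key s₀
    have k1 := key s₁
    rw [hg, if_neg (lt_irrefl _), if_pos (h1.trans h2)] at k0
    rw [hg, if_neg (by linarith), if_neg (lt_irrefl _)] at k1
    refine max_le ?_ ?_
    · rcases le_total s s₀ with h | h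
      · rw [min_eq_left h]
        rw [max_eq_left (by linarith)] at k0
        linarith
      · rw [min_eq_right h]
        rw [max_eq_right (by linarith)] at k0
        linarith
    · rcases le_total s s₁ with h | h
      · rw [min_eq_left h]
        rw [max_eq_left (by linarith)] at k1
        linarith
      · rw [min_eq_right h]
        rw [max_eq_right (by linarith)] at k1
        linarith

/-- The function equals `s₀` from `s₀` up to `s₀ + s₁ - d₁`, where the second branch takes over, and
then rises to `d₁ > s₀` at `s₁`. It lies strictly below the chord from `s₀` to `s₁` at the point of
takeover. -/
theorem not_concaveOn_of_eq_max (h0 : 0 < s₀) (h1 : s₀ < d₁) (h2 : d₁ < s₁) {f : ℝ → ℝ}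
    (hf : ∀ s, 0 ≤ s → f s = max (min s s₀) (min s s₁ - (s₁ - d₁))) :
    ¬ ConcaveOn ℝ (Ioi (0 : ℝ)) f := by
  intro hc
  have hpos : 0 < s₁ - s₀ := by linarith
  have hs₁ : 0 < s₁ := by linarith
  have hc' := hc.2
  have h := @hc' s₀ h0 s₁ hs₁ ((d₁ - s₀) / (s₁ - s₀)) ((s₁ - d₁) / (s₁ - s₀))
    (div_nonneg (by linarith) hpos.le) (div_nonneg (by linarith) hpos.le)
    (by rw [← add_div, div_eq_one_iff_eq hpos.ne']; ring)
  have hm : ((d₁ - s₀) / (s₁ - s₀)) • s₀ + ((s₁ - d₁) / (s₁ - s₀)) • s₁ = s₀ + s₁ - d₁ := by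
    simp only [smul_eq_mul]
    field_simp
    ring
  rw [hm, hf s₀ h0.le, hf s₁ (by linarith), hf _ (by linarith), min_self,
    min_eq_left (show s₀ ≤ s₁ by linarith), min_eq_right (show s₀ ≤ s₁ by linarith), min_self,
    min_eq_right (show s₀ ≤ s₀ + s₁ - d₁ by linarith),
    min_eq_left (show s₀ + s₁ - d₁ ≤ s₁ by linarith), max_eq_left (by linarith),
    max_eq_right (by linarith), max_eq_left (by linarith)] at h
  simp only [smul_eq_mul] at h
  rw [div_mul_eq_mul_div, div_mul_eq_mul_div, ← add_div, div_le_iff₀ hpos] at h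
  nlinarith

end Hull

/-! ### First moment upper bound -/

section UpperBound

variable {μ : Measure ℝ} [IsProbabilityMeasure μ]

/-- If the mass of `T n` is at most a multiple of `r_n ^ γ`, then the limsup set of those balls
whose centres lie in `T n` has dimension at most `1 / α - γ`. -/
theorem ae_dimH_limsup_le {α γ C : ℝ} (hα : 0 < α) {T : ℕ → Set ℝ} (hT : ∀ n, MeasurableSet (T n))
    (hμ : ∀ n : ℕ, μ (T n) ≤ ENNReal.ofReal (C * (((n : ℝ) + 1) ^ (-α)) ^ γ)) :
    ∀ᵐ ω ∂(Measure.infinitePi fun _ : ℕ => μ),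
      dimH (⋂ k : ℕ, ⋃ n : ℕ, ⋃ _ : k ≤ n,
        {x | ω n ∈ T n ∧ x ∈ Metric.closedBall (ω n) (((n : ℝ) + 1) ^ (-α))}) ≤
          ENNReal.ofReal (1 / α - γ) := by
  have key : ∀ t : ℝ, 0 < t → 1 / α - γ < t → ∀ᵐ ω ∂(Measure.infinitePi fun _ : ℕ => μ),
      dimH (⋂ k : ℕ, ⋃ n : ℕ, ⋃ _ : k ≤ n,
        {x | ω n ∈ T n ∧ x ∈ Metric.closedBall (ω n) (((n : ℝ) + 1) ^ (-α))}) ≤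
          ENNReal.ofReal t := by
    intro t ht hαt
    let c : ℕ → ℝ≥0∞ := fun n => ENNReal.ofReal ((2 * ((n : ℝ) + 1) ^ (-α)) ^ t)
    let f : ℕ → (ℕ → ℝ) → ℝ≥0∞ := fun n => ((fun ω => ω n) ⁻¹' T n).indicator fun _ => c n
    have hTn : ∀ n, MeasurableSet ((fun ω : ℕ → ℝ => ω n) ⁻¹' T n) := fun n =>
      measurable_pi_apply n (hT n)
    -- The expected sum of the `t`-th powers of the diameter bounds is at most a multiple of `∑
    -- (n+1)^(-α(t+γ))`, which converges because `t > 1/α - γ`.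
    have hint : ∫⁻ ω, ∑' n, f n ω ∂(Measure.infinitePi fun _ : ℕ => μ) ≠ ⊤ := by
      rw [lintegral_tsum fun n => (measurable_const.indicator (hTn n)).aemeasurable]
      have hle : ∀ n, ∫⁻ ω, f n ω ∂(Measure.infinitePi fun _ : ℕ => μ) ≤
          ENNReal.ofReal (C * 2 ^ t * (1 / |(n : ℝ) + 1| ^ (α * (t + γ)))) := by
        intro n
        have hn : (0 : ℝ) < (n : ℝ) + 1 := by positivity
        rw [lintegral_indicator_const (hTn n)]
        have : (Measure.infinitePi fun _ : ℕ => μ) ((fun ω : ℕ → ℝ => ω n) ⁻¹' T n) = μ (T n) := by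
          rw [← Measure.map_apply (measurable_pi_apply n) (hT n)]
          exact congrArg (fun m : Measure ℝ => m (T n))
            (Measure.infinitePi_map_eval (fun _ : ℕ => μ) n)
        rw [this]
        refine (mul_le_mul_right (hμ n) (c n)).trans (le_of_eq ?_)
        rw [← ENNReal.ofReal_mul (by positivity)]
        congr 1
        rw [Real.mul_rpow (by norm_num) (by positivity), abs_of_pos hn, one_div,
          ← Real.rpow_neg hn.le, ← Real.rpow_mul hn.le, ← Real.rpow_mul hn.le,
          show -(α * (t + γ)) = -α * t + -α * γ by ring, Real.rpow_add hn]
        ring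
      refine ne_top_of_le_ne_top ?_ (ENNReal.tsum_le_tsum hle)
      refine Summable.tsum_ofReal_ne_top (Summable.mul_left _ ?_)
      refine (Real.summable_one_div_nat_add_rpow 1 _).2 ?_
      have h2 : 1 / α < t + γ := by linarith
      rw [div_lt_iff₀ hα] at h2
      linarith
    have hmeas : Measurable fun ω => ∑' n, f n ω :=
      Measurable.tsum fun n => measurable_const.indicator (hTn n)
    filter_upwards [ae_lt_top hmeas hint] with ω hω
    refine dimH_limsup_le ht (ne_top_of_le_ne_top hω.ne (ENNReal.tsum_le_tsum fun n => ?_))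
    by_cases hn : ω n ∈ T n
    · have hr : (0 : ℝ) ≤ ((n : ℝ) + 1) ^ (-α) := by positivity
      rw [show f n ω = c n from indicator_of_mem (s := (fun ω : ℕ → ℝ => ω n) ⁻¹' T n) hn _]
      simp only [c]
      rw [← ENNReal.ofReal_rpow_of_nonneg (by positivity) ht.le]
      gcongr
      refine (Metric.ediam_mono fun x hx => hx.2).trans ?_
      rw [Real.closedBall_eq_Icc, Real.ediam_Icc]
      exact ENNReal.ofReal_le_ofReal (by linarith)
    · rw [show {x | ω n ∈ T n ∧ x ∈ Metric.closedBall (ω n) (((n : ℝ) + 1) ^ (-α))} = ∅ by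
        ext; simp [hn], Metric.ediam_empty, ENNReal.zero_rpow_of_pos ht]
      exact zero_le
  have hq : ∀ q : ℚ, ∀ᵐ ω ∂(Measure.infinitePi fun _ : ℕ => μ), 0 < (q : ℝ) → 1 / α - γ < q →
      dimH (⋂ k : ℕ, ⋃ n : ℕ, ⋃ _ : k ≤ n,
        {x | ω n ∈ T n ∧ x ∈ Metric.closedBall (ω n) (((n : ℝ) + 1) ^ (-α))}) ≤
          ENNReal.ofReal q := by
    intro q
    by_cases h : 0 < (q : ℝ) ∧ 1 / α - γ < q
    · filter_upwards [key q h.1 h.2] with ω hω _ _ using hω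
    · exact ae_of_all _ fun ω h1 h2 => absurd ⟨h1, h2⟩ h
  filter_upwards [ae_all_iff.2 hq] with ω hω
  refine le_of_forall_gt_imp_ge_of_dense fun y hy => ?_
  obtain ⟨q, hq0, hxq, hqy⟩ := ENNReal.lt_iff_exists_rat_btwn.1 hy
  have hq0' : 0 < (q : ℝ) := ENNReal.ofReal_pos.1 (zero_le.trans_lt hxq)
  exact (hω q hq0' ((ENNReal.ofReal_lt_ofReal_iff hq0').1 hxq)).trans hqy.le

/-- The radii tend to 0, so each point of the limsup set is a limit of centres. -/
theorem limsupBalls_subset_of_isClosed {α : ℝ} (hα : 0 < α) {S : Set ℝ} (hS : IsClosed S)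
    {ω : ℕ → ℝ} (hω : ∀ n, ω n ∈ S) : limsupBalls α ω ⊆ S := by
  intro x hx
  refine hS.closure_subset (Metric.mem_closure_iff.2 fun ε hε => ?_)
  have hlim : Tendsto (fun n : ℕ => ((n : ℝ) + 1) ^ (-α)) atTop (𝓝 0) :=
    (tendsto_rpow_neg_atTop hα).comp (tendsto_natCast_atTop_atTop.atTop_add tendsto_const_nhds)
  obtain ⟨K, hK⟩ := eventually_atTop.1 (hlim.eventually (gt_mem_nhds hε))
  obtain ⟨n, hn⟩ := mem_iUnion.1 (mem_iInter.1 hx K)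
  obtain ⟨hKn, hxn⟩ := mem_iUnion.1 hn
  exact ⟨ω n, hω n, (Metric.mem_closedBall.1 hxn).trans_lt (hK n hKn)⟩

end UpperBound

/-! ### Spectra, almost sure dimension and conclusion -/

namespace IsGapData

variable {lam β : ℝ} {a b : (k : ℕ) → (Fin k → Bool) → ℝ} {s₀ s₁ d₁ : ℝ}

theorem exponents_lt (h : IsGapData lam β a b) (hs₀ : s₀ = Real.log 2 / (-Real.log lam))
    (hs₁ : s₁ = β * Real.log 2 / Real.log 3) (hd₁ : d₁ = Real.log 2 / Real.log 3) :
    0 < s₀ ∧ s₀ < d₁ ∧ d₁ < s₁ := by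
  have hlog3 : 0 < Real.log 3 := Real.log_pos (by norm_num)
  have hlog2 : 0 < Real.log 2 := Real.log_pos (by norm_num)
  have hlam : Real.log lam < -Real.log 3 := by
    rw [← Real.log_inv, inv_eq_one_div]
    exact Real.log_lt_log h.lam_pos h.lam_lt
  have hβ := h.one_lt
  subst hs₀ hs₁ hd₁
  refine ⟨div_pos hlog2 (by linarith), ?_, ?_⟩
  · gcongr
    linarith
  · gcongr
    nlinarith

theorem iUnion_support_levelMeasure (h : IsGapData lam β a b) :
    ⋃ k : ℕ, (levelMeasure lam a b k).support =
      ⋃ p : (Σ k : ℕ, Fin k → Bool), range (gapMap lam a b p.1 p.2) := by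
  simp only [h.support_levelMeasure, iUnion_sigma]

theorem upperBoxDim_gapMap_le (h : IsGapData lam β a b)
    (hs₀ : s₀ = Real.log 2 / (-Real.log lam)) (h0 : 0 < s₀) (k : ℕ) (w : Fin k → Bool) :
    upperBoxDim (range (gapMap lam a b k w)) ≤ (s₀ : EReal) :=
  (h.isCoding k w).upperBoxDim_range_le h.lam_pos h.lam_lt_one h0
    (hs₀ ▸ rpow_log_two_div h.lam_pos h.lam_lt_one)

theorem _root_.third_rpow_log_two_div : (1 / 3 : ℝ) ^ (Real.log 2 / Real.log 3) = 1 / 2 := by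
  simpa [Real.rpow_neg] using third_rpow_mul 1

theorem _root_.upperBoxDim_cantorSet_le :
    upperBoxDim cantorSet ≤ ((Real.log 2 / Real.log 3 : ℝ) : EReal) := by
  rw [← range_cantorPoint]
  exact isCoding_cantorPoint.upperBoxDim_range_le (by norm_num) (by norm_num)
    (div_pos (Real.log_pos (by norm_num)) (Real.log_pos (by norm_num))) third_rpow_log_two_div

theorem _root_.le_dimH_cantorSet :
    ENNReal.ofReal (Real.log 2 / Real.log 3) ≤ dimH cantorSet := by
  rw [← range_cantorPoint]
  exact isCoding_cantorPoint.le_dimH_range (by norm_num) (by norm_num)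
    (div_pos (Real.log_pos (by norm_num)) (Real.log_pos (by norm_num))) third_rpow_log_two_div

theorem packingDim_iUnion_range_le (h : IsGapData lam β a b)
    (hs₀ : s₀ = Real.log 2 / (-Real.log lam)) (h0 : 0 < s₀) :
    packingDim (⋃ p : (Σ k : ℕ, Fin k → Bool), range (gapMap lam a b p.1 p.2)) ≤
      ENNReal.ofReal s₀ :=
  packingDim_iUnion_le fun p => h.upperBoxDim_gapMap_le hs₀ h0 p.1 p.2

/-- The points of local dimension at most `s`. -/
theorem setOf_lowerLocalDim_le (h : IsGapData lam β a b) (hs₀ : s₀ = Real.log 2 / (-Real.log lam))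
    (hs₁ : s₁ = β * Real.log 2 / Real.log 3) (h01 : s₀ < s₁) (s : ℝ) :
    {x | lowerLocalDim (gapMeasure lam β a b) x ≤ (s : EReal)} =
      if s < s₀ then ∅ else if s < s₁ then
        ⋃ p : (Σ k : ℕ, Fin k → Bool), range (gapMap lam a b p.1 p.2)
      else cantorSet ∪ ⋃ p : (Σ k : ℕ, Fin k → Bool), range (gapMap lam a b p.1 p.2) := by
  have := h.isProbabilityMeasure
  subst hs₀ hs₁
  have hG : ∀ x ∈ ⋃ p : (Σ k : ℕ, Fin k → Bool), range (gapMap lam a b p.1 p.2),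
      lowerLocalDim (gapMeasure lam β a b) x = ((Real.log 2 / (-Real.log lam) : ℝ) : EReal) := by
    intro x hx
    obtain ⟨p, hp⟩ := mem_iUnion.1 hx
    exact (h.localDim_of_mem_range hp).1
  have hC : ∀ x ∈ cantorSet, lowerLocalDim (gapMeasure lam β a b) x =
      ((β * Real.log 2 / Real.log 3 : ℝ) : EReal) := fun x hx => (h.localDim_of_mem_cantorSet hx).1
  ext x
  rw [mem_ofPred_eq]
  by_cases hx : x ∈ (gapMeasure lam β a b).support
  · rw [h.support_gapMeasure, h.iUnion_support_levelMeasure] at hx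
    rcases hx with hx | hx
    · have hnG : x ∉ ⋃ p : (Σ k : ℕ, Fin k → Bool), range (gapMap lam a b p.1 p.2) := by
        intro hG
        obtain ⟨p, hp⟩ := mem_iUnion.1 hG
        exact h.range_disjoint_cantorSet hp hx
      rw [hC x hx, EReal.coe_le_coe_iff]
      split_ifs with h1 h2
      · simp only [mem_empty_iff_false, iff_false, not_le]
        exact h1.trans h01
      · simp only [hnG, iff_false, not_le]
        exact h2
      · simp only [mem_union, hx, true_or, iff_true]
        exact not_lt.1 h2
    · rw [hG x hx, EReal.coe_le_coe_iff]
      split_ifs with h1 h2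
      · simpa using h1
      · simpa only [hx, iff_true] using not_lt.1 h1
      · simpa only [mem_union, hx, or_true, iff_true] using not_lt.1 h1
  · rw [(localDim_eq_top hx).1, top_le_iff]
    simp only [EReal.coe_ne_top, false_iff]
    rw [h.support_gapMeasure, h.iUnion_support_levelMeasure, mem_union, not_or] at hx
    split_ifs
    · exact notMem_empty x
    · exact hx.2
    · exact fun h => h.elim hx.1 hx.2

/-- The Hausdorff and packing spectra. -/
theorem spectra_eq (h : IsGapData lam β a b) (hs₀ : s₀ = Real.log 2 / (-Real.log lam))
    (hs₁ : s₁ = β * Real.log 2 / Real.log 3) (hd₁ : d₁ = Real.log 2 / Real.log 3) (s : ℝ) :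
    hausdorffSpectrum (gapMeasure lam β a b) s =
      (if s < s₀ then 0 else if s < s₁ then ENNReal.ofReal s₀ else ENNReal.ofReal d₁) ∧
    packingSpectrum (gapMeasure lam β a b) s =
      (if s < s₀ then 0 else if s < s₁ then ENNReal.ofReal s₀ else ENNReal.ofReal d₁) := by
  have := h.isProbabilityMeasure
  obtain ⟨h0, h1, h2⟩ := h.exponents_lt hs₀ hs₁ hd₁
  -- Off the support the local dimension is `⊤`, so the two spectra measure the same set.
  have hsup : {x | x ∈ (gapMeasure lam β a b).support ∧
      lowerLocalDim (gapMeasure lam β a b) x ≤ (s : EReal)} =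
      {x | lowerLocalDim (gapMeasure lam β a b) x ≤ (s : EReal)} := by
    ext x
    refine ⟨fun hx => hx.2, fun hx => ⟨by_contra fun hne => ?_, hx⟩⟩
    rw [mem_ofPred_eq, (localDim_eq_top hne).1, top_le_iff] at hx
    exact EReal.coe_ne_top _ hx
  have hle := dimH_le_packingDim {x | lowerLocalDim (gapMeasure lam β a b) x ≤ (s : EReal)}
  rw [hausdorffSpectrum, packingSpectrum, hsup]
  -- As `dimH ≤ packingDim`, an upper bound for the packing dimension and an equal lower bound for
  -- the Hausdorff dimension settle both.
  suffices hs : packingDim {x | lowerLocalDim (gapMeasure lam β a b) x ≤ (s : EReal)} ≤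
      (if s < s₀ then 0 else if s < s₁ then ENNReal.ofReal s₀ else ENNReal.ofReal d₁) ∧
      (if s < s₀ then 0 else if s < s₁ then ENNReal.ofReal s₀ else ENNReal.ofReal d₁) ≤
      dimH {x | lowerLocalDim (gapMeasure lam β a b) x ≤ (s : EReal)} from
    ⟨le_antisymm (hle.trans hs.1) hs.2, le_antisymm hs.1 (hs.2.trans hle)⟩
  rw [h.setOf_lowerLocalDim_le hs₀ hs₁ (h1.trans h2)]
  split_ifs with hs0 hs1
  · refine ⟨?_, zero_le⟩
    have := packingDim_iUnion_le (A := fun _ : Unit => (∅ : Set ℝ)) (t := 0) fun _ => ?_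
    · simpa using this
    · exact upperBoxDim_empty_le
  · refine ⟨h.packingDim_iUnion_range_le hs₀ h0, ?_⟩
    refine ((h.isCoding 0 ![]).le_dimH_range h.lam_pos h.lam_lt_one h0
      (hs₀ ▸ rpow_log_two_div h.lam_pos h.lam_lt_one)).trans (dimH_mono ?_)
    exact subset_iUnion (fun p : (Σ k : ℕ, Fin k → Bool) => range (gapMap lam a b p.1 p.2)) ⟨0, ![]⟩
  · constructor
    · have := packingDim_iUnion_le (t := d₁) (A := fun p : Option (Σ k : ℕ, Fin k → Bool) =>
        p.elim cantorSet fun p => range (gapMap lam a b p.1 p.2)) fun p => ?_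
      · rwa [iUnion_option] at this
      · cases p with
        | none => exact hd₁ ▸ upperBoxDim_cantorSet_le
        | some p =>
          exact (h.upperBoxDim_gapMap_le hs₀ h0 p.1 p.2).trans (EReal.coe_le_coe_iff.2 h1.le)
    · exact hd₁ ▸ le_dimH_cantorSet.trans (dimH_mono subset_union_left)

/-- The almost sure dimension of the random limsup set. -/
theorem ae_dimH_limsupBalls (h : IsGapData lam β a b) (hs₀ : s₀ = Real.log 2 / (-Real.log lam))
    (hs₁ : s₁ = β * Real.log 2 / Real.log 3) (hd₁ : d₁ = Real.log 2 / Real.log 3) {α : ℝ}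
    (hα : 0 < α) :
    ∀ᵐ ω ∂(Measure.infinitePi fun _ : ℕ => gapMeasure lam β a b), dimH (limsupBalls α ω) =
      ENNReal.ofReal (max (min (1 / α) s₀) (min (1 / α) s₁ - (s₁ - d₁))) := by
  have := h.isProbabilityMeasure
  obtain ⟨h0, h1, h2⟩ := h.exponents_lt hs₀ hs₁ hd₁
  have hq := two_rpow_one_sub_lt_one h.one_lt
  have hγ : (β - 1) * Real.log 2 / Real.log 3 = s₁ - d₁ := by
    rw [hs₁, hd₁]
    ring
  have hs₀' := rpow_log_two_div h.lam_pos h.lam_lt_one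
  rw [← hs₀] at hs₀'
  have hd₁' := third_rpow_log_two_div
  rw [← hd₁] at hd₁'
  obtain ⟨A, hA, hAF⟩ := (h.isCoding 0 ![]).upper
  have hUm : ∀ (m : ℕ) (u : Fin m → Bool),
      MeasurableSet (gapMap lam a b 0 ![] '' {v | AgreeBelow m (extendFalse u) v}) := by
    intro m u
    refine (IsClosed.isCompact ?_ |>.image
      ((h.isCoding 0 ![]).continuous h.lam_lt_one)).isClosed.measurableSet
    rw [agreeBelow_eq]
    simp only [ofPred_forall]
    exact isClosed_iInter fun i => isClosed_iInter fun _ =>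
      isClosed_eq (continuous_apply i) continuous_const
  -- The copy of level 0 suffices here. The sets `U` are its own cylinders, whose mass exponent `D`
  -- equals the dimension `s₀`, so there is no loss `D - d`.
  have hlow₀ := ae_le_dimH_limsupBalls (μ := gapMeasure lam β a b) (D := s₀)
    (c := (1 - 2 ^ (1 - β)) * 2 ^ (-β * (0 : ℕ)))
    (U := fun m u => gapMap lam a b 0 ![] '' {v | AgreeBelow m (extendFalse u) v})
    (h.isCoding 0 ![]) h.lam_pos h.lam_lt_one h0 hs₀' hα
    (mul_pos (by linarith) (by positivity)) hA
    hUm (fun m u v huv => ?_) (fun m u => ?_) (fun m u y hy => ?_)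
  rotate_left
  · rw [Function.onFun, Set.disjoint_left]
    rintro _ ⟨x, hx, rfl⟩ ⟨y, hy, hxy⟩
    rw [(h.isCoding 0 ![]).injective h.lam_pos hxy] at hy
    refine huv ?_
    rw [← extendFalse_restrict u, ← extendFalse_restrict v]
    ext i
    rw [hx i i.2, hy i i.2]
  · refine le_trans ?_ (h.map_le_gapMeasure 0 ![] (hUm m u))
    rw [ENNReal.ofReal_mul (mul_nonneg (by linarith) (by positivity)),
      Measure.map_apply (h.measurable_gapMap 0 ![]) (hUm m u), ← two_inv_pow_eq h.lam_pos hs₀',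
      ← coinMeasure_agreeBelow m (extendFalse u)]
    gcongr
    exact subset_preimage_image _ _
  · obtain ⟨v, hv, rfl⟩ := hy
    refine hAF u v m fun i hi => ?_
    rw [← hv i hi]
    simp [extendFalse, hi]
  -- The tree is now the Cantor set, while the centres fall in the nearby middle ninths, of mass at
  -- least a multiple of `(3^(-m))^(s₁)`; the loss is `D - d = s₁ - d₁`.
  have hlow₁ := ae_le_dimH_limsupBalls (μ := gapMeasure lam β a b) (D := s₁)
    (c := 1 - 2 ^ (1 - β)) (A := 1) (U := fun m u => middleNinth u)
    isCoding_cantorPoint (by norm_num) (by norm_num) (h0.trans h1) hd₁' hα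
    (by linarith) one_pos (fun m u => measurableSet_middleNinth u) disjoint_middleNinth
    (fun m u => by rw [hs₁, third_pow_rpow_mul]; exact h.le_gapMeasure_middleNinth m u)
    (fun m u y hy => by rw [one_mul]; exact abs_cantorPoint_sub_le hy)
  have hup₀ := ae_dimH_limsup_le (μ := gapMeasure lam β a b) (γ := 0) (C := 1) hα
    (T := fun _ => univ) (fun _ => MeasurableSet.univ) fun n => by simp
  have hup₁ := ae_dimH_limsup_le (μ := gapMeasure lam β a b) (γ := s₁ - d₁)
    (C := 27 ^ (s₁ - d₁)) hα (T := fun n => Metric.cthickening (((n : ℝ) + 1) ^ (-α)) cantorSet)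
    (fun n => Metric.isClosed_cthickening.measurableSet) fun n => by
      rw [← Real.mul_rpow (by norm_num) (by positivity), ← hγ]
      exact h.gapMeasure_cthickening_le (by positivity)
  have hsupp : ∀ᵐ ω ∂(Measure.infinitePi fun _ : ℕ => gapMeasure lam β a b),
      ∀ n, ω n ∈ (gapMeasure lam β a b).support := by
    rw [ae_all_iff]
    exact fun n => (measurePreserving_eval_infinitePi (fun _ : ℕ => gapMeasure lam β a b)
      n).quasiMeasurePreserving.ae (Measure.support_mem_ae (μ := gapMeasure lam β a b))
  filter_upwards [hlow₀, hlow₁, hup₀, hup₁, hsupp] with ω hl₀ hl₁ hu₀ hu₁ hω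
  have hmin : min (1 / α) s₁ - (s₁ - d₁) = min d₁ (1 / α - (s₁ - d₁)) := by
    rw [← min_sub_sub_right, min_comm, sub_sub_cancel]
  rw [sub_self, sub_zero, min_comm] at hl₀
  refine le_antisymm ?_ ?_
  · rw [sub_zero] at hu₀
    have hE : dimH (limsupBalls α ω) ≤ ENNReal.ofReal (1 / α) := by
      refine (dimH_mono ?_).trans hu₀
      exact iInter_mono fun k => iUnion_mono fun n => iUnion_mono fun _ x hx => ⟨mem_univ _, hx⟩
    -- A ball that contains a point of the Cantor set has its centre within its radius of that set,
    -- so only the balls counted in `hup₁` matter.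
    have hEC : dimH (limsupBalls α ω ∩ cantorSet) ≤ ENNReal.ofReal (1 / α - (s₁ - d₁)) := by
      refine (dimH_mono fun x hx => ?_).trans hu₁
      refine mem_iInter.2 fun k => ?_
      obtain ⟨n, hn⟩ := mem_iUnion.1 (mem_iInter.1 hx.1 k)
      obtain ⟨hkn, hxn⟩ := mem_iUnion.1 hn
      refine mem_iUnion.2 ⟨n, mem_iUnion.2 ⟨hkn, ?_, hxn⟩⟩
      rw [Metric.mem_closedBall, dist_comm] at hxn
      exact Metric.mem_cthickening_of_dist_le _ x _ _ hx.2 hxn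
    have hC : dimH cantorSet ≤ ENNReal.ofReal d₁ := by
      refine dimH_le_of_upperBoxDim_le (upperBoxDim_cantorSet_le.trans ?_)
      rw [EReal.coe_ennreal_ofReal, ← hd₁]
      exact EReal.coe_le_coe_iff.2 (le_max_left _ _)
    have hG : dimH (⋃ p : (Σ k : ℕ, Fin k → Bool), range (gapMap lam a b p.1 p.2)) ≤
        ENNReal.ofReal s₀ :=
      (dimH_le_packingDim _).trans (h.packingDim_iUnion_range_le hs₀ h0)
    have hsub := limsupBalls_subset_of_isClosed hα Measure.isClosed_support hω
    rw [h.support_gapMeasure, h.iUnion_support_levelMeasure] at hsub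
    calc dimH (limsupBalls α ω)
        = dimH (limsupBalls α ω ∩ cantorSet ∪ limsupBalls α ω ∩
            ⋃ p : (Σ k : ℕ, Fin k → Bool), range (gapMap lam a b p.1 p.2)) := by
          rw [← inter_union_distrib_left, inter_eq_left.2 hsub]
      _ ≤ _ := by
          rw [dimH_union, ENNReal.ofReal_max, max_comm]
          refine max_le_max ?_ ?_
          · rw [ENNReal.ofReal_min]
            exact le_min ((dimH_mono inter_subset_left).trans hE)
              ((dimH_mono inter_subset_right).trans hG)
          · rw [hmin, ENNReal.ofReal_min]
            exact le_min ((dimH_mono inter_subset_right).trans hC) hEC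
  · rw [ENNReal.ofReal_max, hmin]
    exact max_le hl₀ hl₁

end IsGapData

theorem mainTheorem5 (lam β : ℝ) (hlam0 : 0 < lam) (hlam1 : lam < 1 / 3) (hβ : 1 < β)
    (a b : (k : ℕ) → (Fin k → Bool) → ℝ)
    (ha : ∀ (k : ℕ) (w : Fin k → Bool), a k w ≠ 0)
    (hab : ∀ (k : ℕ) (w : Fin k → Bool), ∀ x ∈ (bernoulliConvolution lam).support,
      a k w * x + b k w ∈ middleNinth w)
    (μ : Measure ℝ) (hμ : μ = gapMeasure lam β a b)
    (s₀ s₁ d₁ : ℝ) (hs₀ : s₀ = Real.log 2 / (-Real.log lam))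
    (hs₁ : s₁ = β * Real.log 2 / Real.log 3) (hd₁ : d₁ = Real.log 2 / Real.log 3) :
    IsProbabilityMeasure μ ∧
    -- the support
    μ.support = cantorSet ∪ ⋃ k : ℕ, (levelMeasure lam a b k).support ∧
    -- the local dimensions
    (∀ x : ℝ, lowerLocalDim μ x = upperLocalDim μ x) ∧
    (∀ k : ℕ, ∀ x ∈ (levelMeasure lam a b k).support, lowerLocalDim μ x = (s₀ : EReal)) ∧
    (∀ x ∈ cantorSet, lowerLocalDim μ x = (s₁ : EReal)) ∧
    (∀ x : ℝ, x ∉ μ.support → lowerLocalDim μ x = ⊤) ∧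
    -- the Hausdorff and packing spectra
    (∀ s : ℝ, hausdorffSpectrum μ s =
      if s < s₀ then 0 else if s < s₁ then ENNReal.ofReal s₀ else ENNReal.ofReal d₁) ∧
    (∀ s : ℝ, packingSpectrum μ s = hausdorffSpectrum μ s) ∧
    -- the increasing 1-Lipschitz hull of the Hausdorff spectrum, which is not concave
    (∀ s : ℝ, 0 ≤ s →
      hausdorffSpectrumHull μ s = max (min s s₀) (min s s₁ - (s₁ - d₁))) ∧
    ¬ ConcaveOn ℝ (Ioi (0 : ℝ)) (hausdorffSpectrumHull μ) ∧
    -- the almost sure dimension of the random limsup sets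
    (∀ α : ℝ, 0 < α →
      (∀ᵐ ω ∂(Measure.infinitePi fun _ : ℕ => μ),
        dimH (limsupBalls α ω) = coveringDim μ α) ∧
      coveringDim μ α = ENNReal.ofReal (hausdorffSpectrumHull μ (1 / α)) ∧
      (1 / α ≤ s₁ →
        ENNReal.ofReal (1 / α - (β - 1) * (Real.log 2 / Real.log 3)) ≤ coveringDim μ α)) := by
  subst hμ
  have h : IsGapData lam β a b := ⟨hlam0, hlam1, hβ, ha, fun k w u => hab k w _ (by
    rw [support_bernoulliConvolution hlam0 (by linarith)]
    exact mem_range_self u)⟩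
  have hprob := h.isProbabilityMeasure
  obtain ⟨h0, h1, h2⟩ := h.exponents_lt hs₀ hs₁ hd₁
  have hlevel : ∀ k, ∀ x ∈ (levelMeasure lam a b k).support,
      lowerLocalDim (gapMeasure lam β a b) x = (s₀ : EReal) ∧
      upperLocalDim (gapMeasure lam β a b) x = (s₀ : EReal) := by
    intro k x hx
    rw [h.support_levelMeasure] at hx
    obtain ⟨w, hw⟩ := mem_iUnion.1 hx
    exact hs₀ ▸ h.localDim_of_mem_range hw
  have hcantor : ∀ x ∈ cantorSet,
      lowerLocalDim (gapMeasure lam β a b) x = (s₁ : EReal) ∧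
      upperLocalDim (gapMeasure lam β a b) x = (s₁ : EReal) := fun x hx =>
    hs₁ ▸ h.localDim_of_mem_cantorSet hx
  have hspec := h.spectra_eq hs₀ hs₁ hd₁
  have hhull : ∀ s : ℝ, 0 ≤ s → hausdorffSpectrumHull (gapMeasure lam β a b) s =
      max (min s s₀) (min s s₁ - (s₁ - d₁)) := by
    intro s hs
    refine increasingLipschitzHull_step h0 h1 h2 (fun z => ?_) hs
    rw [(hspec z).1]
    split_ifs
    · rfl
    · exact ENNReal.toReal_ofReal h0.le
    · exact ENNReal.toReal_ofReal (h0.trans h1).le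
  refine ⟨hprob, h.support_gapMeasure, fun x => ?_, fun k x hx => (hlevel k x hx).1,
    fun x hx => (hcantor x hx).1, fun x hx => (localDim_eq_top hx).1, fun s => (hspec s).1,
    fun s => (hspec s).2.trans (hspec s).1.symm, hhull,
    not_concaveOn_of_eq_max h0 h1 h2 hhull, fun α hα => ?_⟩
  · by_cases hx : x ∈ (gapMeasure lam β a b).support
    · rw [h.support_gapMeasure] at hx
      rcases hx with hx | hx
      · rw [(hcantor x hx).1, (hcantor x hx).2]
      · obtain ⟨k, hk⟩ := mem_iUnion.1 hx
        rw [(hlevel k x hk).1, (hlevel k x hk).2]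
    · rw [(localDim_eq_top hx).1, (localDim_eq_top hx).2]
  · have hae := h.ae_dimH_limsupBalls hs₀ hs₁ hd₁ hα
    have hα' : 0 ≤ 1 / α := by positivity
    -- The essential supremum of an almost surely constant function is that constant, the law being
    -- nonzero.
    have hcov : coveringDim (gapMeasure lam β a b) α =
        ENNReal.ofReal (hausdorffSpectrumHull (gapMeasure lam β a b) (1 / α)) := by
      rw [coveringDim, essSup_congr_ae hae, essSup_const _ (IsProbabilityMeasure.ne_zero _),
        hhull _ hα']
    refine ⟨?_, hcov, fun hle => ?_⟩
    · filter_upwards [hae] with ω hω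
      rw [hω, hcov, hhull _ hα']
    · rw [hcov, hhull _ hα']
      refine ENNReal.ofReal_le_ofReal (le_max_of_le_right (le_of_eq ?_))
      rw [min_eq_left hle, hs₁, hd₁]
      ring
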